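/- Let $\mathbb{D}$ be the open unit disc in $\mathbb{C}$ and $m$ the Lebesgue measure. For $t>-1$ let $\lambda_t$ be the probability measure $d\lambda_t(z)=\frac{t+1}{\pi}(1-|z|^2)^t\,dm(z)$ on $\mathbb{D}$, let $P^{(t)}$ be the orthogonal projection of $L^2(\mathbb{D},\lambda_t)$ onto its closed subspace of functions holomorphic on $\mathbb{D}$, and, for a bounded measurable function $g$ on $\mathbb{D}$, let $H^{(t)}_g=(I-P^{(t)})M_gP^{(t)}$ be the Hankel operator on $L^2(\mathbb{D},\lambda_t)$, where $M_g$ is multiplication by $g$. Write $\|T\|_{S^2}^2=\operatorname{Tr}(T^*T)$ for the square of the Hilbert--Schmidt norm and $\bar\partial g=\frac12\left(\frac{\partial g}{\partial x}+i\frac{\partial g}{\partial y}\right)$. Suppose $t>-1$ and $g\in C^2(\overline{\mathbb{D}})$ is real-valued and subharmonic in $\mathbb{D}$. Then $|\bar\partial g|^2$ is integrable on $\mathbb{D}$, $H^{(t)}_g$ is a Hilbert--Schmidt operator, and $$\|H^{(t)}_g\|_{S^2}^2\le\frac1\pi\int_{\mathbb{D}}|\bar\partial g|^2\,dm,$$ with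 equality if and only if $g$ is harmonic in $\mathbb{D}$. -/

import Mathlib

namespace BergmanHankel

open MeasureTheory Metric Filter Topology
open scoped ENNReal

noncomputable section

/-! ### Weighted Bergman spaces on the unit disc -/

/-- The measure `dλ_t(z) = ((t + 1) / π) (1 - |z|²)^t dm(z)` on the open unit disc, seen as a
measure on `ℂ` carried by the disc. It is a probability measure for `t > -1`. -/
def weightedMeasure (t : ℝ) : Measure ℂ :=
  (volume.restrict (ball (0 : ℂ) 1)).withDensity
    fun z => ENNReal.ofReal ((t + 1) / Real.pi * (1 - ‖z‖ ^ 2) ^ t)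

/-- The Hilbert space `L²(𝔻, λ_t)`. -/
abbrev WeightedL2 (t : ℝ) : Type := Lp ℂ 2 (weightedMeasure t)

/-- The weighted Bergman space: the elements of `L²(𝔻, λ_t)` that are represented by a function
holomorphic on the open unit disc. -/
def bergmanSpace (t : ℝ) : Submodule ℂ (WeightedL2 t) where
  carrier := {f | ∃ F : ℂ → ℂ, DifferentiableOn ℂ F (ball 0 1) ∧ f =ᵐ[weightedMeasure t] F}
  zero_mem' := ⟨0, differentiableOn_const 0, Lp.coeFn_zero _ _ _⟩
  add_mem' := by
    rintro f g ⟨F, hF, hfF⟩ ⟨G, hG, hgG⟩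
    refine ⟨F + G, hF.add hG, ?_⟩
    filter_upwards [Lp.coeFn_add f g, hfF, hgG] with z h1 h2 h3
    rw [h1.trans (Pi.add_apply _ _ _), h2, h3, Pi.add_apply]
  smul_mem' := by
    rintro c f ⟨F, hF, hfF⟩
    refine ⟨c • F, hF.const_smul c, ?_⟩
    filter_upwards [Lp.coeFn_smul c f, hfF] with z h1 h2
    simp [h1, h2]

/-- Mean value property over discs. -/
theorem setIntegral_ball_eq {F : ℂ → ℂ} {c : ℂ} {r : ℝ}
    (hF : DiffContOnCl ℂ F (ball c r)) :
    ∫ z in ball c r, F z = volume.real (ball c r) • F c := by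
  rcases le_or_gt r 0 with hr | hr
  · simp [ball_eq_empty.2 hr]
  set G : ℂ → ℂ := fun u => F (c + u) with hG
  have hpre : (fun u : ℂ => c + u) ⁻¹' ball c r = ball 0 r := by
    ext u; simp [dist_eq_norm]
  have hmp : MeasurePreserving (fun u : ℂ => c + u) volume volume :=
    measurePreserving_add_left volume c
  have h1 : ∫ z in ball c r, F z = ∫ u in ball (0 : ℂ) r, G u := by
    rw [← hpre]
    exact (hmp.setIntegral_preimage_emb (MeasurableEquiv.addLeft c).measurableEmbedding F _).symm
  have hcont : ContinuousOn F (closedBall c r) := by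
    have := hF.continuousOn
    rwa [closure_ball c hr.ne'] at this
  have hGc : ContinuousOn G (closedBall 0 r) := by
    refine hcont.comp (by fun_prop) ?_
    intro u hu
    simpa [dist_eq_norm] using hu
  have hrot : ∀ θ : ℝ, ∫ u in ball (0 : ℂ) r, G (Complex.exp (θ * Complex.I) * u)
      = ∫ u in ball (0 : ℂ) r, G u := by
    intro θ
    let e : ℂ ≃ₗᵢ[ℝ] ℂ := rotation (Circle.exp θ)
    have he : ∀ u, e u = Complex.exp (θ * Complex.I) * u := by
      intro u; simp [e, rotation_apply]
    have hpre' : e ⁻¹' ball 0 r = ball 0 r := by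
      ext u; simp
    have := e.measurePreserving.setIntegral_preimage_emb
      e.toHomeomorph.measurableEmbedding G (ball 0 r)
    rw [hpre'] at this
    rw [← this]
    simp [he]
  have hmean : ∀ u ∈ ball (0 : ℂ) r,
      ∫ θ in (0 : ℝ)..2 * Real.pi, G (Complex.exp (θ * Complex.I) * u) = (2 * Real.pi) • F c := by
    intro u hu
    have hu' : ‖u‖ < r := by simpa using hu
    have hd : DiffContOnCl ℂ F (ball c |‖u‖|) := by
      rw [abs_norm]; exact hF.mono (ball_subset_ball hu'.le)
    have h2 := hd.circleAverage
    rw [Real.circleAverage_eq_integral_add (Complex.arg u)] at h2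
    have h3 : ∀ θ : ℝ, F (circleMap c ‖u‖ (θ + Complex.arg u))
        = G (Complex.exp (θ * Complex.I) * u) := by
      intro θ
      simp only [hG, circleMap]
      congr 2
      conv_rhs => rw [← Complex.norm_mul_exp_arg_mul_I u]
      push_cast
      rw [add_mul, Complex.exp_add]
      ring
    simp only [h3] at h2
    rw [← h2, smul_smul, mul_inv_cancel₀ (by positivity), one_smul]
  have hint : Integrable (Function.uncurry fun (θ : ℝ) (u : ℂ) =>
      G (Complex.exp (θ * Complex.I) * u))
      ((volume.restrict (Set.uIoc 0 (2 * Real.pi))).prod (volume.restrict (ball (0 : ℂ) r))) := by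
    rw [Measure.prod_restrict]
    have hK : IsCompact (Set.uIcc 0 (2 * Real.pi) ×ˢ closedBall (0 : ℂ) r) :=
      isCompact_uIcc.prod (isCompact_closedBall _ _)
    refine IntegrableOn.mono_set (t := Set.uIcc 0 (2 * Real.pi) ×ˢ closedBall (0 : ℂ) r) ?_
      (Set.prod_mono Set.uIoc_subset_uIcc ball_subset_closedBall)
    refine ContinuousOn.integrableOn_compact hK ?_
    refine hGc.comp (by fun_prop) ?_
    rintro ⟨θ, u⟩ ⟨-, hu⟩
    simpa [Complex.norm_exp_ofReal_mul_I] using hu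
  have hfub := intervalIntegral_integral_swap (μ := volume.restrict (ball (0 : ℂ) r))
    (a := 0) (b := 2 * Real.pi) hint
  simp only [hrot] at hfub
  rw [setIntegral_congr_fun measurableSet_ball hmean] at hfub
  simp only [intervalIntegral.integral_const, sub_zero, integral_const, measureReal_restrict_apply,
    MeasurableSet.univ, Set.univ_inter] at hfub
  rw [smul_comm] at hfub
  have h4 := smul_right_injective ℂ (by positivity : (2 * Real.pi) ≠ 0) hfub
  rw [h1, h4]
  have hv : volume.real (ball (0 : ℂ) r) = volume.real (ball c r) := by
    simp [measureReal_def]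
  rw [hv]

theorem weightedMeasure_of_le {t : ℝ} (ht : t ≤ -1) : weightedMeasure t = 0 := by
  unfold weightedMeasure
  rw [withDensity_eq_zero_iff]
  · filter_upwards [ae_restrict_mem measurableSet_ball] with z hz
    have hz' : ‖z‖ < 1 := by simpa using hz
    have : 0 ≤ (1 - ‖z‖ ^ 2) ^ t := Real.rpow_nonneg (by nlinarith [norm_nonneg z]) t
    refine ENNReal.ofReal_of_nonpos (mul_nonpos_of_nonpos_of_nonneg ?_ this)
    exact div_nonpos_of_nonpos_of_nonneg (by linarith) Real.pi_pos.le
  · fun_prop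

/-- On smaller discs, Lebesgue measure is bounded by a multiple of `λ_t`. -/
theorem exists_restrict_le {t : ℝ} (ht : -1 < t) {ρ : ℝ} (hρ : ρ < 1) :
    ∃ C : ℝ≥0∞, C ≠ ∞ ∧ volume.restrict (closedBall (0 : ℂ) ρ) ≤ C • weightedMeasure t := by
  have hcont : ContinuousOn (fun z : ℂ => (t + 1) / Real.pi * (1 - ‖z‖ ^ 2) ^ t)
      (closedBall 0 ρ) := by
    refine continuousOn_const.mul (ContinuousOn.rpow_const (by fun_prop) ?_)
    intro z hz
    left
    have : ‖z‖ ≤ ρ := by simpa using hz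
    nlinarith [norm_nonneg z]
  have hpos : ∀ z ∈ closedBall (0 : ℂ) ρ, 0 < (t + 1) / Real.pi * (1 - ‖z‖ ^ 2) ^ t := by
    intro z hz
    have : ‖z‖ ≤ ρ := by simpa using hz
    have h1 : 0 < 1 - ‖z‖ ^ 2 := by nlinarith [norm_nonneg z]
    have h2 : 0 < t + 1 := by linarith
    positivity
  obtain ⟨a, ha, hle⟩ : ∃ a : ℝ, 0 < a ∧ ∀ z ∈ closedBall (0 : ℂ) ρ,
      a ≤ (t + 1) / Real.pi * (1 - ‖z‖ ^ 2) ^ t :=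
    (isCompact_closedBall (0 : ℂ) ρ).exists_forall_le' hcont hpos
  refine ⟨(ENNReal.ofReal a)⁻¹, by simpa using ha, ?_⟩
  have hsub : closedBall (0 : ℂ) ρ ⊆ ball 0 1 := closedBall_subset_ball hρ
  refine Measure.le_iff.2 fun s hs => ?_
  have ha0 : ENNReal.ofReal a ≠ 0 := by simpa using ha
  have h1 : ENNReal.ofReal a * volume (s ∩ closedBall (0 : ℂ) ρ) ≤ weightedMeasure t s := by
    rw [weightedMeasure, withDensity_apply _ hs, Measure.restrict_restrict hs,
      ← setLIntegral_const]
    refine (setLIntegral_mono' (hs.inter measurableSet_closedBall) ?_).trans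
      (lintegral_mono_set (Set.inter_subset_inter_right s hsub))
    intro z hz
    exact ENNReal.ofReal_le_ofReal (hle z hz.2)
  rw [Measure.restrict_apply hs, Measure.smul_apply, smul_eq_mul]
  calc volume (s ∩ closedBall (0 : ℂ) ρ)
      = (ENNReal.ofReal a)⁻¹ * (ENNReal.ofReal a * volume (s ∩ closedBall (0 : ℂ) ρ)) := by
        rw [← mul_assoc, ENNReal.inv_mul_cancel ha0 ENNReal.ofReal_ne_top, one_mul]
    _ ≤ _ := by gcongr

/-- Point evaluations are bounded, uniformly on smaller discs. -/
theorem exists_enorm_le {t : ℝ} (ht : -1 < t) {ρ : ℝ} (hρ : ρ < 1) :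
    ∃ C : ℝ≥0∞, C ≠ ∞ ∧ ∀ F : ℂ → ℂ, DifferentiableOn ℂ F (ball 0 1) →
      ∀ z ∈ closedBall (0 : ℂ) ρ, ‖F z‖ₑ ≤ C * eLpNorm F 2 (weightedMeasure t) := by
  obtain ⟨r, hr0, hr1⟩ : ∃ r : ℝ, 0 < r ∧ ρ + r < 1 := ⟨(1 - ρ) / 2, by linarith, by linarith⟩
  obtain ⟨C, hC, hle⟩ := exists_restrict_le ht hr1
  set V : ℝ≥0∞ := volume (ball (0 : ℂ) r) with hV
  have hV0 : V ≠ 0 := (measure_ball_pos volume (0 : ℂ) hr0).ne'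
  have hVt : V ≠ ∞ := measure_ball_lt_top.ne
  refine ⟨V⁻¹ * (C ^ (1 / (2 : ℝ≥0∞).toReal) * V ^ (1 / (1 : ℝ≥0∞).toReal - 1 / (2 : ℝ≥0∞).toReal)),
    by finiteness, ?_⟩
  intro F hF z hz
  have hz' : ‖z‖ ≤ ρ := by simpa using hz
  have hsub1 : closedBall z r ⊆ closedBall 0 (ρ + r) :=
    closedBall_subset_closedBall' (by rw [dist_zero_right]; linarith)
  have hsub : closedBall z r ⊆ ball 0 1 := hsub1.trans (closedBall_subset_ball hr1)
  have hd : DiffContOnCl ℂ F (ball z r) := by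
    refine (hF.mono ?_).diffContOnCl
    rwa [closure_ball z hr0.ne']
  have hVz : volume (ball z r) = V := by simp [hV]
  have h1 := setIntegral_ball_eq hd
  have h2 : V * ‖F z‖ₑ ≤ eLpNorm F 1 (volume.restrict (ball z r)) := by
    have h3 : ‖volume.real (ball z r) • F z‖ₑ = V * ‖F z‖ₑ := by
      rw [enorm_smul, ← hVz, measureReal_def, Real.enorm_eq_ofReal ENNReal.toReal_nonneg,
        ENNReal.ofReal_toReal (by rw [hVz]; exact hVt)]
    rw [← h3, ← h1, eLpNorm_one_eq_lintegral_enorm]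
    exact enorm_integral_le_lintegral_enorm _
  have hmeas : AEStronglyMeasurable F (volume.restrict (ball z r)) :=
    ((hF.continuousOn.mono (ball_subset_closedBall.trans hsub)).aestronglyMeasurable
      measurableSet_ball)
  have h4 := eLpNorm_le_eLpNorm_mul_rpow_measure_univ (p := 1) (q := 2) (by norm_num) hmeas
  rw [Measure.restrict_apply_univ, hVz] at h4
  have h5 : eLpNorm F 2 (volume.restrict (ball z r))
      ≤ C ^ (1 / (2 : ℝ≥0∞).toReal) * eLpNorm F 2 (weightedMeasure t) := by
    have h6 : volume.restrict (ball z r) ≤ C • weightedMeasure t :=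
      (Measure.restrict_mono (ball_subset_closedBall.trans hsub1) le_rfl).trans hle
    refine (eLpNorm_mono_measure F h6).trans ?_
    rw [eLpNorm_smul_measure_of_ne_top (by norm_num)]
    simp
  calc ‖F z‖ₑ = V⁻¹ * (V * ‖F z‖ₑ) := by
        rw [← mul_assoc, ENNReal.inv_mul_cancel hV0 hVt, one_mul]
    _ ≤ V⁻¹ * ((C ^ (1 / (2 : ℝ≥0∞).toReal) * eLpNorm F 2 (weightedMeasure t)) *
        V ^ (1 / (1 : ℝ≥0∞).toReal - 1 / (2 : ℝ≥0∞).toReal)) := by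
        refine mul_le_mul_right ?_ _
        exact (h2.trans h4).trans (mul_le_mul_left h5 _)
    _ = _ := by ring

theorem isClosed_bergmanSpace (t : ℝ) : IsClosed (bergmanSpace t : Set (WeightedL2 t)) := by
  rcases le_or_gt t (-1) with ht | ht
  · have : (bergmanSpace t : Set (WeightedL2 t)) = Set.univ := by
      refine Set.eq_univ_of_forall fun f => ⟨0, differentiableOn_const 0, ?_⟩
      exact measure_mono_null (Set.subset_univ _) (by simp [weightedMeasure_of_le ht])
    rw [this]
    exact isClosed_univ
  refine IsSeqClosed.isClosed ?_
  intro f g hf hfg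
  choose F hFd hfF using hf
  have hcau : ∀ ρ < (1 : ℝ), UniformCauchySeqOn F atTop (closedBall 0 ρ) := by
    intro ρ hρ
    obtain ⟨C, hC, hle⟩ := exists_enorm_le ht hρ
    rw [Metric.uniformCauchySeqOn_iff]
    intro ε hε
    have hc := hfg.cauchySeq
    rw [Metric.cauchySeq_iff] at hc
    obtain ⟨N, hN⟩ := hc (ε / (C.toReal + 1)) (by positivity)
    refine ⟨N, fun m hm n hn z hz => ?_⟩
    have h1 := hle (F m - F n) ((hFd m).sub (hFd n)) z hz
    have h2 : eLpNorm (F m - F n) 2 (weightedMeasure t) = ENNReal.ofReal (dist (f m) (f n)) := by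
      rw [← edist_dist, Lp.edist_def]
      exact eLpNorm_congr_ae ((hfF m).symm.sub (hfF n).symm)
    rw [h2] at h1
    have h3 : dist (F m z) (F n z) ≤ C.toReal * dist (f m) (f n) := by
      have h4 := ENNReal.toReal_mono (by finiteness) h1
      rw [ENNReal.toReal_mul, ENNReal.toReal_ofReal dist_nonneg] at h4
      simpa [dist_eq_norm] using h4
    have h5 := hN m hm n hn
    rw [lt_div_iff₀ (by positivity)] at h5
    nlinarith [dist_nonneg (x := f m) (y := f n), ENNReal.toReal_nonneg (a := C)]
  have hlim : ∀ z : ℂ, ∃ w : ℂ, z ∈ ball (0 : ℂ) 1 → Tendsto (fun n => F n z) atTop (𝓝 w) := by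
    intro z
    by_cases hz : z ∈ ball (0 : ℂ) 1
    · have hz' : ‖z‖ < 1 := by simpa using hz
      obtain ⟨w, hw⟩ := cauchySeq_tendsto_of_complete
        ((hcau ‖z‖ hz').cauchySeq (x := z) (by simp))
      exact ⟨w, fun _ => hw⟩
    · exact ⟨0, fun h => absurd h hz⟩
  choose G hG using hlim
  have hloc : TendstoLocallyUniformlyOn F G atTop (ball 0 1) := by
    rw [tendstoLocallyUniformlyOn_iff_forall_isCompact isOpen_ball]
    intro K hK hKc
    obtain ⟨ρ, hρ, hKρ⟩ : ∃ ρ < (1 : ℝ), K ⊆ closedBall 0 ρ := by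
      rcases K.eq_empty_or_nonempty with rfl | hne
      · exact ⟨0, by norm_num, by simp⟩
      · obtain ⟨x, hx, hmax⟩ := hKc.exists_isMaxOn hne continuous_norm.continuousOn
        exact ⟨‖x‖, by simpa using hK hx, fun y hy => by simpa using hmax hy⟩
    exact ((hcau ρ hρ).mono hKρ).tendstoUniformlyOn_of_tendsto fun z hz => hG z (hK hz)
  refine ⟨G, hloc.differentiableOn (Eventually.of_forall hFd) isOpen_ball, ?_⟩
  obtain ⟨φ, hφ, hae⟩ := (tendstoInMeasure_of_tendsto_Lp hfg).exists_seq_tendsto_ae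
  have hball : ∀ᵐ z ∂(weightedMeasure t), z ∈ ball (0 : ℂ) 1 :=
    (withDensity_absolutelyContinuous _ _).ae_le (ae_restrict_mem measurableSet_ball)
  filter_upwards [hae, hball, ae_all_iff.2 hfF] with z h1 h2 h3
  refine tendsto_nhds_unique h1 ?_
  simp only [h3]
  exact (hG z h2).comp hφ.tendsto_atTop

instance (t : ℝ) : CompleteSpace (bergmanSpace t) :=
  (isClosed_bergmanSpace t).completeSpace_coe

/-- The Bergman projection `P^{(t)}`: the orthogonal projection of `L²(𝔻, λ_t)` onto the weighted
Bergman space. -/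
def bergmanProjection (t : ℝ) : WeightedL2 t →L[ℂ] WeightedL2 t :=
  (bergmanSpace t).starProjection

/-! ### Multiplication and Hankel operators -/

/-- The operator `M_g` of multiplication by an essentially bounded function `g` on
`L²(𝔻, λ_t)`. -/
def mulOp (t : ℝ) (g : ℂ → ℂ) (hg : MemLp g ∞ (weightedMeasure t)) :
    WeightedL2 t →L[ℂ] WeightedL2 t :=
  (ContinuousLinearMap.mul ℂ ℂ).holderL (weightedMeasure t) ∞ 2 2 (hg.toLp g)

theorem mulOp_coeFn (t : ℝ) (g : ℂ → ℂ) (hg : MemLp g ∞ (weightedMeasure t)) (f : WeightedL2 t) :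
    mulOp t g hg f =ᵐ[weightedMeasure t] fun z => g z * f z := by
  have h := (ContinuousLinearMap.mul ℂ ℂ).coeFn_holder (r := 2) (hg.toLp g) f
  filter_upwards [h, hg.coeFn_toLp] with z h1 h2
  have h3 : mulOp t g hg f z = (ContinuousLinearMap.mul ℂ ℂ) (hg.toLp g z) (f z) := h1
  rw [h3, h2]
  rfl

/-- The Hankel operator `H_g^{(t)} = (I - P^{(t)}) M_g P^{(t)}` on `L²(𝔻, λ_t)`. -/
def hankel (t : ℝ) (g : ℂ → ℂ) (hg : MemLp g ∞ (weightedMeasure t)) :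
    WeightedL2 t →L[ℂ] WeightedL2 t :=
  (ContinuousLinearMap.id ℂ (WeightedL2 t) - bergmanProjection t) ∘L mulOp t g hg ∘L
    bergmanProjection t

theorem memLp_top_of_continuousOn (t : ℝ) {g : ℂ → ℂ} (hg : ContinuousOn g (closedBall 0 1)) :
    MemLp g ∞ (weightedMeasure t) := by
  obtain ⟨C, hC⟩ := (isCompact_closedBall (0 : ℂ) 1).exists_bound_of_continuousOn hg
  have hac : weightedMeasure t ≪ volume.restrict (ball (0 : ℂ) 1) :=
    withDensity_absolutelyContinuous _ _
  refine memLp_top_of_bound (C := C)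
    (((hg.mono ball_subset_closedBall).aestronglyMeasurable measurableSet_ball).mono_ac hac) ?_
  refine hac.ae_le ?_
  filter_upwards [ae_restrict_mem measurableSet_ball] with z hz
  exact hC z (ball_subset_closedBall hz)

/-- A real function of class `C²` on the closed unit disc is a bounded symbol. -/
theorem memLp_top_of_contDiffOn (t : ℝ) {g : ℂ → ℝ} (hg : ContDiffOn ℝ 2 g (closedBall 0 1)) :
    MemLp (fun z => (g z : ℂ)) ∞ (weightedMeasure t) :=
  memLp_top_of_continuousOn t (Complex.continuous_ofReal.comp_continuousOn hg.continuousOn)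

/-! ### Hilbert–Schmidt norm -/

section HilbertSchmidt

variable {E : Type*} [NormedAddCommGroup E] [InnerProductSpace ℂ E]

theorem enorm_sq_eq_tsum {ι : Type*} (b : HilbertBasis ι ℂ E) (x : E) :
    ‖x‖ₑ ^ 2 = ∑' i, ‖inner ℂ (b i) x‖ₑ ^ 2 := by
  have h := b.hasSum_inner_mul_inner x x
  have h1 : ∀ i, inner ℂ x (b i) * inner ℂ (b i) x = ((‖inner ℂ (b i) x‖ ^ 2 : ℝ) : ℂ) := by
    intro i
    rw [← inner_conj_symm, mul_comm, Complex.mul_conj, Complex.normSq_eq_norm_sq]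
  simp only [h1, inner_self_eq_norm_sq_to_K] at h
  have h2 : HasSum (fun i => ‖inner ℂ (b i) x‖ ^ 2) (‖x‖ ^ 2) := by
    rw [← Complex.hasSum_ofReal]
    simpa using h
  have h3 := ENNReal.ofReal_tsum_of_nonneg (fun i => by positivity) h2.summable
  rw [h2.tsum_eq] at h3
  have h4 : ∀ y : ℝ, 0 ≤ y → ENNReal.ofReal (y ^ 2) = ENNReal.ofReal y ^ 2 :=
    fun y hy => ENNReal.ofReal_pow hy 2
  simpa only [h4 _ (norm_nonneg _), ofReal_norm] using h3

variable [CompleteSpace E]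

/-- The square of the Hilbert–Schmidt norm, `‖T‖²_{S²} = Tr(T* T) = ∑ ‖T e‖²`, the sum running over
an orthonormal basis; its value is `∞` when `T` is not a Hilbert–Schmidt operator. -/
def hsNormSq (T : E →L[ℂ] E) : ℝ≥0∞ :=
  ∑' e : (exists_hilbertBasis ℂ E).choose, ‖T e‖ₑ ^ 2

theorem tsum_enorm_sq_eq_adjoint {ι κ : Type*} (b : HilbertBasis ι ℂ E) (c : HilbertBasis κ ℂ E)
    (T : E →L[ℂ] E) :
    ∑' k, ‖T (c k)‖ₑ ^ 2 = ∑' i, ‖ContinuousLinearMap.adjoint T (b i)‖ₑ ^ 2 := by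
  have h1 : ∀ k, ‖T (c k)‖ₑ ^ 2 = ∑' i, ‖inner ℂ (b i) (T (c k))‖ₑ ^ 2 :=
    fun k => enorm_sq_eq_tsum b _
  have h2 : ∀ i, ‖ContinuousLinearMap.adjoint T (b i)‖ₑ ^ 2
      = ∑' k, ‖inner ℂ (c k) (ContinuousLinearMap.adjoint T (b i))‖ₑ ^ 2 :=
    fun i => enorm_sq_eq_tsum c _
  simp only [h1, h2]
  rw [ENNReal.tsum_comm]
  refine tsum_congr fun i => tsum_congr fun k => ?_
  rw [← ContinuousLinearMap.adjoint_inner_left, ← inner_conj_symm, RCLike.enorm_conj]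

/-- The Hilbert–Schmidt norm may be computed in every orthonormal basis. -/
theorem hsNormSq_eq_tsum {ι : Type*} (b : HilbertBasis ι ℂ E) (T : E →L[ℂ] E) :
    hsNormSq T = ∑' i, ‖T (b i)‖ₑ ^ 2 := by
  obtain ⟨b', hb'⟩ := (exists_hilbertBasis ℂ E).choose_spec
  rw [tsum_enorm_sq_eq_adjoint b b, ← tsum_enorm_sq_eq_adjoint b b', hsNormSq]
  simp [hb']

end HilbertSchmidt

/-! ### Wirtinger derivative and subharmonic functions -/

/-- `∂̄g = (∂g/∂x + i ∂g/∂y) / 2`. -/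
def dbar (g : ℂ → ℂ) (z : ℂ) : ℂ :=
  (1 / 2) * (fderiv ℝ g z 1 + Complex.I * fderiv ℝ g z Complex.I)

/-- Real-valued subharmonic functions on an open set `U`: upper semicontinuous functions whose
value at the centre of every closed disc in `U` is at most their mean over the bounding circle. -/
def IsSubharmonicOn (u : ℂ → ℝ) (U : Set ℂ) : Prop :=
  UpperSemicontinuousOn u U ∧
    ∀ (c : ℂ) (r : ℝ), 0 < r → closedBall c r ⊆ U →
      CircleIntegrable u c r ∧ u c ≤ Real.circleAverage u c r

end

end BergmanHankel

namespace BergmanHankel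

open MeasureTheory Metric Filter Topology
open scoped ENNReal

noncomputable section

open Laplacian

/-! ### Jensen's formula for functions of class `C²` -/

/-! The proof computes the Hilbert–Schmidt norm exactly, as the Dirichlet integral minus a defect
that subharmonicity makes nonnegative.

Write `P` for the Bergman projection, `M` for multiplication by `g` and `H = (I - P) M P`. As `g` is
real, `M P - P M = H - H*`, where `H` and `H*` have orthogonal ranges, so the commutator has squared
norm `2 ‖H‖²`. The commutator is an integral operator with kernel `(g w - g z)` times the Bergman
kernel. The substitution `w = φ_z ξ`, with `φ_z = mob z` the involution of the disc exchanging `0`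
and `z`, gives `2 ‖H‖² = ((t + 1) / π) ∫ ∫ (g (φ_z ξ) - g z)² dλ_t(ξ) dμ(z)`, where `μ` is the
Möbius invariant measure `dm / (1 - |z|²)²` (`two_mul_hsNormSq_hankel`).

The inner integral is the mean of a function that vanishes at `0`. Jensen's formula averaged over
`λ_t` writes it as the integral of the Laplacian against a radial Green potential `N`
(`integral_weightedMeasure_sub_eq_laplacian`). The Laplacian of `(g - c)²` is `2 (|∇g|² + (g - c)
Δg)`, and it transforms conformally. Since `|φ_w x| = |φ_x w|` and `μ` is invariant, Fubini allows
integration over `w` first. The gradient term then only meets the total mass `∫ N dμ = 1 / (4 (t +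
1))`, and the other term yields `-Δg(x) D(x)`, where `D(x) = ∫ (g (φ_x z) - g x) N(z) dμ(z)` is
`meanDefect`. Hence (`hsNormSq_hankel_eq`) `‖H‖² = (1 / 4π) ∫ |∇g|² dm - ((t + 1) / π) ∫ Δg D dm`,
and `|∂̄g|² = |∇g|² / 4`.

For subharmonic `g`, `Δg ≥ 0`. As `g ∘ φ_x` is again subharmonic and `N dμ` is radial, `D ≥ 0`, with
`D(x) > 0` wherever `Δg(x) > 0`. This gives the inequality, and equality forces `Δg = 0` throughout
the disc. -/

theorem laplacian_eq_fderiv_fderiv (G : ℂ → ℝ) (z : ℂ) :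
    Δ G z = fderiv ℝ (fderiv ℝ G) z 1 1 + fderiv ℝ (fderiv ℝ G) z Complex.I Complex.I := by
  simp [InnerProductSpace.laplacian_eq_iteratedFDeriv_complexPlane, iteratedFDeriv_two_apply]

theorem continuousOn_laplacian {G : ℂ → ℝ} {R : ℝ} (hG : ContDiffOn ℝ 2 G (ball 0 R)) :
    ContinuousOn (Δ G) (ball 0 R) := by
  have h1 : ContDiffOn ℝ 1 (fderiv ℝ G) (ball 0 R) :=
    hG.fderiv_of_isOpen isOpen_ball (by norm_num)
  have h2 := h1.continuousOn_fderiv_of_isOpen isOpen_ball le_rfl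
  refine ContinuousOn.congr ?_ fun z _ => laplacian_eq_fderiv_fderiv G z
  exact ((h2.clm_apply continuousOn_const).clm_apply continuousOn_const).add
    ((h2.clm_apply continuousOn_const).clm_apply continuousOn_const)

/-- The vectors `a` and `a i` are orthogonal of equal length, so the left side is `‖a‖²` times the
trace; the mixed terms cancel without symmetry of `B`. This is the source of every conformal factor
below. -/
theorem bilinear_add_bilinear_mul_I (B : ℂ →L[ℝ] ℂ →L[ℝ] ℝ) (a : ℂ) :
    B a a + B (a * Complex.I) (a * Complex.I)
      = ‖a‖ ^ 2 * (B 1 1 + B Complex.I Complex.I) := by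
  have h1 : a = a.re • (1 : ℂ) + a.im • Complex.I := by
    simp [Complex.re_add_im]
  have h2 : a * Complex.I = (-a.im) • (1 : ℂ) + a.re • Complex.I := by
    apply Complex.ext <;> simp
  rw [h2, ← Complex.normSq_eq_norm_sq, Complex.normSq_apply]
  conv_lhs => rw [h1]
  simp only [map_add, map_smul, add_apply, smul_apply, smul_eq_mul]
  simp
  ring

/-- Continuity is asked of `ρ f` rather than of `f`, because `f` will have a logarithmic singularity
at the origin that the Jacobian `ρ` absorbs. -/
theorem setIntegral_ball_eq_polar {f : ℂ → ℝ} {r : ℝ} (hr : 0 < r)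
    (hf : ContinuousOn (fun p : ℝ × ℝ => p.1 * f (circleMap 0 p.1 p.2))
      (Set.Icc 0 r ×ˢ Set.Icc (-Real.pi) Real.pi)) :
    ∫ z in ball (0 : ℂ) r, f z
      = ∫ ρ in (0 : ℝ)..r, ∫ θ in (-Real.pi)..Real.pi, ρ * f (circleMap 0 ρ θ) := by
  have hπ : -Real.pi ≤ Real.pi := by linarith [Real.pi_pos]
  have hint : IntegrableOn (fun p : ℝ × ℝ => p.1 * f (circleMap 0 p.1 p.2))
      (Set.Ioo 0 r ×ˢ Set.Ioo (-Real.pi) Real.pi) (volume.prod volume) :=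
    (hf.integrableOn_compact (isCompact_Icc.prod isCompact_Icc)).mono_set
      (Set.prod_mono Set.Ioo_subset_Icc_self Set.Ioo_subset_Icc_self)
  rw [← integral_indicator measurableSet_ball, ← Complex.integral_comp_polarCoord_symm,
    polarCoord_target]
  have h1 : ∀ p ∈ Set.Ioi (0 : ℝ) ×ˢ Set.Ioo (-Real.pi) Real.pi,
      p.1 • (ball (0 : ℂ) r).indicator f (Complex.polarCoord.symm p)
      = (Set.Ioo 0 r ×ˢ Set.Ioo (-Real.pi) Real.pi).indicator
        (fun p : ℝ × ℝ => p.1 * f (circleMap 0 p.1 p.2)) p := by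
    rintro ⟨ρ, θ⟩ ⟨hρ, hθ⟩
    simp only [Set.mem_Ioi] at hρ
    have h2 : Complex.polarCoord.symm (ρ, θ) = circleMap 0 ρ θ := by
      simp [circleMap, Complex.exp_mul_I]
    rw [h2]
    by_cases h : ρ < r
    · rw [Set.indicator_of_mem, Set.indicator_of_mem, smul_eq_mul]
      · exact ⟨⟨hρ, h⟩, hθ⟩
      · simp [abs_of_pos hρ, h]
    · rw [Set.indicator_of_notMem, Set.indicator_of_notMem, smul_zero]
      · exact fun h' => h h'.1.2
      · simpa [abs_of_pos hρ] using h
  rw [setIntegral_congr_fun (measurableSet_Ioi.prod measurableSet_Ioo) h1,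
    setIntegral_indicator (measurableSet_Ioo.prod measurableSet_Ioo),
    Set.inter_eq_right.2 (Set.prod_mono Set.Ioo_subset_Ioi_self le_rfl), Measure.volume_eq_prod,
    setIntegral_prod _ hint, intervalIntegral.integral_of_le hr.le, integral_Ioc_eq_integral_Ioo]
  refine setIntegral_congr_fun measurableSet_Ioo fun ρ _ => ?_
  simp only
  rw [intervalIntegral.integral_of_le hπ, integral_Ioc_eq_integral_Ioo]

theorem setLIntegral_ball_eq_polar {f : ℝ → ℝ≥0∞} (hf : Measurable f) (r : ℝ) :
    ∫⁻ z in ball (0 : ℂ) r, f ‖z‖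
      = ENNReal.ofReal (2 * Real.pi) * ∫⁻ ρ in Set.Ioo 0 r, ENNReal.ofReal ρ * f ρ := by
  rw [← lintegral_indicator measurableSet_ball, ← Complex.lintegral_comp_polarCoord_symm,
    polarCoord_target]
  have h1 : ∀ p ∈ Set.Ioi (0 : ℝ) ×ˢ Set.Ioo (-Real.pi) Real.pi,
      ENNReal.ofReal p.1 • (ball (0 : ℂ) r).indicator (fun z => f ‖z‖) (Complex.polarCoord.symm p)
      = (Set.Ioo 0 r).indicator (fun ρ : ℝ => ENNReal.ofReal ρ * f ρ) p.1 := by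
    rintro ⟨ρ, θ⟩ ⟨hρ, hθ⟩
    simp only [Set.mem_Ioi] at hρ
    by_cases h : ρ < r
    · rw [Set.indicator_of_mem, Set.indicator_of_mem, smul_eq_mul, Complex.norm_polarCoord_symm,
        abs_of_pos hρ]
      · exact ⟨hρ, h⟩
      · simpa only [mem_ball_zero_iff, Complex.norm_polarCoord_symm, abs_of_pos hρ] using h
    · rw [Set.indicator_of_notMem, Set.indicator_of_notMem, smul_zero]
      · exact fun h' => h h'.2
      · simpa only [mem_ball_zero_iff, Complex.norm_polarCoord_symm, abs_of_pos hρ] using h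
  have hm : Measurable fun ρ : ℝ => ENNReal.ofReal ρ * f ρ := by fun_prop
  rw [setLIntegral_congr_fun (measurableSet_Ioi.prod measurableSet_Ioo) h1,
    Measure.volume_eq_prod, ← Measure.prod_restrict,
    lintegral_prod (fun p : ℝ × ℝ => (Set.Ioo 0 r).indicator (fun ρ => ENNReal.ofReal ρ * f ρ) p.1)
      ((hm.indicator measurableSet_Ioo).comp measurable_fst).aemeasurable]
  simp only [lintegral_const, Measure.restrict_apply MeasurableSet.univ, Set.univ_inter,
    Real.volume_Ioo]
  rw [lintegral_mul_const _ (hm.indicator measurableSet_Ioo),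
    setLIntegral_indicator measurableSet_Ioo, Set.inter_eq_left.2 Set.Ioo_subset_Ioi_self, mul_comm]
  congr 2
  ring

theorem intervalIntegrable_log_div {r : ℝ} (hr : 0 < r) :
    IntervalIntegrable (fun ρ => Real.log (r / ρ)) volume 0 r := by
  refine IntervalIntegrable.congr (f := fun ρ => Real.log r - Real.log ρ) ?_ ?_
  · intro ρ hρ
    rw [Set.uIoc_of_le hr.le] at hρ
    simp only
    rw [Real.log_div hr.ne' hρ.1.ne']
  · exact intervalIntegrable_const.sub intervalIntegral.intervalIntegrable_log'

/-- Integration by parts: `log (r / ρ) ρ γ' + γ` is an antiderivative. Its first term vanishes at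
`r` because `log 1 = 0` and at `0` because `ρ log ρ → 0`. -/
theorem integral_log_mul_eq_sub {γ γ' δ : ℝ → ℝ} {r : ℝ} (hr : 0 < r)
    (hγ : ContinuousOn γ (Set.Icc 0 r)) (hγd : ∀ ρ ∈ Set.Ioo 0 r, HasDerivAt γ (γ' ρ) ρ)
    (hγ' : ContinuousOn γ' (Set.Icc 0 r))
    (hδ : ∀ ρ ∈ Set.Ioo 0 r, HasDerivAt (fun ρ => ρ * γ' ρ) (δ ρ) ρ)
    (hδc : ContinuousOn δ (Set.Icc 0 r)) :
    ∫ ρ in (0 : ℝ)..r, Real.log (r / ρ) * δ ρ = γ r - γ 0 := by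
  -- Rewritten through `ρ log ρ`, which is continuous at `0`; the conventions for `r / 0` and `log
  -- 0` make the two forms agree there.
  have h0 : ∀ ρ ∈ Set.Icc 0 r, (Real.log r * ρ - ρ * Real.log ρ) * γ' ρ + γ ρ
      = Real.log (r / ρ) * (ρ * γ' ρ) + γ ρ := by
    rintro ρ ⟨hρ, -⟩
    rcases hρ.eq_or_lt with rfl | hρ
    · simp
    · rw [Real.log_div hr.ne' hρ.ne']; ring
  have h1 : ContinuousOn (fun ρ => Real.log (r / ρ) * (ρ * γ' ρ) + γ ρ) (Set.Icc 0 r) := by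
    refine ContinuousOn.congr ?_ fun ρ hρ => (h0 ρ hρ).symm
    refine (ContinuousOn.mul ?_ hγ').add hγ
    exact ((continuous_const.mul continuous_id).sub Real.continuous_mul_log).continuousOn
  have h2 : ∀ ρ ∈ Set.Ioo 0 r, HasDerivAt (fun ρ => Real.log (r / ρ) * (ρ * γ' ρ) + γ ρ)
      (Real.log (r / ρ) * δ ρ) ρ := by
    rintro ρ hρ
    have hl : HasDerivAt (fun ρ => Real.log (r / ρ)) (-1 / ρ) ρ := by
      have h3 : HasDerivAt (fun ρ => Real.log r - Real.log ρ) (-1 / ρ) ρ := by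
        refine ((Real.hasDerivAt_log hρ.1.ne').const_sub (Real.log r)).congr_deriv ?_
        rw [neg_div, one_div]
      refine h3.congr_of_eventuallyEq ?_
      filter_upwards [Ioo_mem_nhds hρ.1 hρ.2] with x hx
      rw [Real.log_div hr.ne' hx.1.ne']
    refine ((hl.mul (hδ ρ hρ)).add (hγd ρ hρ)).congr_deriv ?_
    have := hρ.1.ne'
    field_simp
    ring
  have h3 : IntervalIntegrable (fun ρ => Real.log (r / ρ) * δ ρ) volume 0 r := by
    exact (intervalIntegrable_log_div hr).mul_continuousOn (by rwa [Set.uIcc_of_le hr.le])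
  rw [intervalIntegral.integral_eq_sub_of_hasDerivAt_of_le hr.le h1 h2 h3]
  simp [hr.ne']

theorem hasDerivAt_clm_comp_apply {L : ℂ → ℂ →L[ℝ] ℝ} {B : ℂ →L[ℝ] ℂ →L[ℝ] ℝ} {c v : ℝ → ℂ}
    {c' v' : ℂ} {s : ℝ} (hL : HasFDerivAt L B (c s)) (hc : HasDerivAt c c' s)
    (hv : HasDerivAt v v' s) :
    HasDerivAt (fun x => L (c x) (v x)) (B c' (v s) + L (c s) v') s := by
  have h1 : HasDerivAt (fun x => L (c x)) (B c') s := hL.comp_hasDerivAt s hc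
  exact h1.clm_apply hv

theorem continuousOn_slice_left {X Y F : Type*} [TopologicalSpace X] [TopologicalSpace Y]
    [TopologicalSpace F] {f : X → Y → F} {s : Set X} {t : Set Y}
    (hf : ContinuousOn (fun p : X × Y => f p.1 p.2) (s ×ˢ t)) {y : Y} (hy : y ∈ t) :
    ContinuousOn (fun x => f x y) s :=
  ContinuousOn.comp (f := fun x => (x, y)) hf (by fun_prop) fun _ hx => ⟨hx, hy⟩

theorem continuousOn_slice_right {X Y F : Type*} [TopologicalSpace X] [TopologicalSpace Y]
    [TopologicalSpace F] {f : X → Y → F} {s : Set X} {t : Set Y}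
    (hf : ContinuousOn (fun p : X × Y => f p.1 p.2) (s ×ˢ t)) {x : X} (hx : x ∈ s) :
    ContinuousOn (fun y => f x y) t :=
  ContinuousOn.comp (f := fun y => (x, y)) hf (by fun_prop) fun _ hy => ⟨hx, hy⟩

/-- Along each ray the one-variable formula expresses `G (r e^{iθ}) - G 0` through `∂_ρ (ρ ∂_ρ G)`.
Integrated over the circle, this quantity may be replaced by `ρ Δ G`, since the difference is the
`θ`-derivative of a periodic function. -/
theorem circleAverage_sub_eq_integral_laplacian {G : ℂ → ℝ} {r R : ℝ} (hr : 0 < r) (hrR : r < R)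
    (hG : ContDiffOn ℝ 2 G (ball 0 R)) :
    Real.circleAverage G 0 r - G 0
      = (2 * Real.pi)⁻¹ * ∫ z in ball (0 : ℂ) r, Real.log (r / ‖z‖) * Δ G z := by
  have hπ : -Real.pi ≤ Real.pi := by linarith [Real.pi_pos]
  have hGc : ContinuousOn G (ball 0 R) := hG.continuousOn
  have hG1 : ContDiffOn ℝ 1 (fderiv ℝ G) (ball 0 R) :=
    hG.fderiv_of_isOpen isOpen_ball (by norm_num)
  have hG1c : ContinuousOn (fderiv ℝ G) (ball 0 R) := hG1.continuousOn
  have hG2c : ContinuousOn (fderiv ℝ (fderiv ℝ G)) (ball 0 R) :=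
    hG1.continuousOn_fderiv_of_isOpen isOpen_ball le_rfl
  have hd1 : ∀ z ∈ ball (0 : ℂ) R, HasFDerivAt G (fderiv ℝ G z) z := fun z hz =>
    ((hG.contDiffAt (isOpen_ball.mem_nhds hz)).differentiableAt (by norm_num)).hasFDerivAt
  have hd2 : ∀ z ∈ ball (0 : ℂ) R, HasFDerivAt (fderiv ℝ G) (fderiv ℝ (fderiv ℝ G) z) z :=
    fun z hz =>
      ((hG1.contDiffAt (isOpen_ball.mem_nhds hz)).differentiableAt (by norm_num)).hasFDerivAt
  obtain ⟨e, he⟩ : ∃ e : ℝ → ℂ, e = circleMap 0 1 := ⟨_, rfl⟩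
  have hee : ∀ ρ θ, circleMap 0 ρ θ = ρ * e θ := by intro ρ θ; simp [he, circleMap]
  have he1 : ∀ θ, ‖e θ‖ = 1 := by intro θ; simp [he]
  have hec : Continuous e := by rw [he]; fun_prop
  have hmem : ∀ ρ ∈ Set.Icc 0 r, ∀ θ, circleMap 0 ρ θ ∈ ball (0 : ℂ) R := by
    intro ρ hρ θ
    simpa [abs_of_nonneg hρ.1] using hρ.2.trans_lt hrR
  have hK : IsCompact (Set.Icc 0 r ×ˢ Set.Icc (-Real.pi) Real.pi) :=
    isCompact_Icc.prod isCompact_Icc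
  have hcm : Continuous fun p : ℝ × ℝ => circleMap 0 p.1 p.2 := by
    simp only [hee]; fun_prop
  have hmaps : Set.MapsTo (fun p : ℝ × ℝ => circleMap 0 p.1 p.2) (Set.Icc 0 r ×ˢ Set.Icc (-Real.pi) Real.pi) (ball (0 : ℂ) R) :=
    fun p hp => hmem p.1 hp.1 p.2
  -- `δ ρ θ` is `∂_ρ (ρ ∂_ρ G)` along the ray of angle `θ`.
  obtain ⟨δ, hδ⟩ : ∃ δ : ℝ → ℝ → ℝ, ∀ ρ θ, δ ρ θ = fderiv ℝ G (circleMap 0 ρ θ) (e θ)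
    + ρ * fderiv ℝ (fderiv ℝ G) (circleMap 0 ρ θ) (e θ) (e θ) := ⟨_, fun _ _ => rfl⟩
  have hK1 : ContinuousOn (fun p : ℝ × ℝ => fderiv ℝ G (circleMap 0 p.1 p.2)) (Set.Icc 0 r ×ˢ Set.Icc (-Real.pi) Real.pi) :=
    hG1c.comp hcm.continuousOn hmaps
  have hK2 : ContinuousOn (fun p : ℝ × ℝ => fderiv ℝ (fderiv ℝ G) (circleMap 0 p.1 p.2)) (Set.Icc 0 r ×ˢ Set.Icc (-Real.pi) Real.pi) :=
    hG2c.comp hcm.continuousOn hmaps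
  have hδK : ContinuousOn (fun p : ℝ × ℝ => δ p.1 p.2) (Set.Icc 0 r ×ˢ Set.Icc (-Real.pi) Real.pi) := by
    have he' : ContinuousOn (fun p : ℝ × ℝ => e p.2) (Set.Icc 0 r ×ˢ Set.Icc (-Real.pi) Real.pi) := by fun_prop
    simp only [hδ]
    exact (hK1.clm_apply he').add
      (continuousOn_fst.mul ((hK2.clm_apply he').clm_apply he'))
  have hLK : ContinuousOn (fun p : ℝ × ℝ => Δ G (circleMap 0 p.1 p.2))
      (Set.Icc 0 r ×ˢ Set.Icc (-Real.pi) Real.pi) :=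
    (continuousOn_laplacian hG).comp hcm.continuousOn hmaps
  have hline : ∀ θ ρ, HasDerivAt (fun ρ : ℝ => circleMap 0 ρ θ) (e θ) ρ := by
    intro θ ρ
    simp only [hee]
    simpa using (Complex.ofRealCLM.hasDerivAt (x := ρ)).mul_const (e θ)
  have hrad : ∀ θ ∈ Set.Icc (-Real.pi) Real.pi,
      ∫ ρ in (0 : ℝ)..r, Real.log (r / ρ) * δ ρ θ = G (circleMap 0 r θ) - G 0 := by
    intro θ hθ
    have hc1 : ContinuousOn (fun ρ => δ ρ θ) (Set.Icc 0 r) := continuousOn_slice_left hδK hθ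
    have hc2 : ContinuousOn (fun ρ : ℝ => fderiv ℝ G (circleMap 0 ρ θ)) (Set.Icc 0 r) :=
      continuousOn_slice_left (f := fun (ρ : ℝ) θ => fderiv ℝ G (circleMap 0 ρ θ)) hK1 hθ
    have h1 := integral_log_mul_eq_sub (γ := fun ρ => G (circleMap 0 ρ θ)) (γ' := fun ρ => fderiv ℝ G (circleMap 0 ρ θ) (e θ))
      (δ := fun ρ => δ ρ θ) hr ?_ ?_ ?_ ?_ ?_
    · simpa using h1
    · exact hGc.comp (by simp only [hee]; fun_prop) fun ρ hρ => hmem ρ hρ θ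
    · intro ρ hρ
      exact (hd1 _ (hmem ρ (Set.Ioo_subset_Icc_self hρ) θ)).comp_hasDerivAt ρ (hline θ ρ)
    · exact hc2.clm_apply continuousOn_const
    · intro ρ hρ
      have h2 := hasDerivAt_clm_comp_apply (c := fun ρ : ℝ => circleMap 0 ρ θ) (s := ρ)
        (hd2 _ (hmem ρ (Set.Ioo_subset_Icc_self hρ) θ)) (hline θ ρ) (hasDerivAt_const ρ (e θ))
      refine ((hasDerivAt_id ρ).mul h2).congr_deriv ?_
      simp [hδ]
    · exact hc1
  have hang : ∀ ρ ∈ Set.Icc 0 r, ∫ θ in (-Real.pi)..Real.pi, δ ρ θ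
      = ∫ θ in (-Real.pi)..Real.pi, ρ * Δ G (circleMap 0 ρ θ) := by
    intro ρ hρ
    have hc1 : ContinuousOn (fun θ => δ ρ θ) (Set.uIcc (-Real.pi) Real.pi) := by
      rw [Set.uIcc_of_le hπ]; exact continuousOn_slice_right hδK hρ
    have hc2 : ContinuousOn (fun θ => Δ G (circleMap 0 ρ θ)) (Set.uIcc (-Real.pi) Real.pi) := by
      rw [Set.uIcc_of_le hπ]
      exact continuousOn_slice_right (f := fun (ρ : ℝ) θ => Δ G (circleMap 0 ρ θ)) hLK hρ
    have hi1 : IntervalIntegrable (fun θ => δ ρ θ) volume (-Real.pi) Real.pi :=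
      hc1.intervalIntegrable
    have hi2 : IntervalIntegrable (fun θ => ρ * Δ G (circleMap 0 ρ θ)) volume
        (-Real.pi) Real.pi :=
      (continuousOn_const.mul hc2).intervalIntegrable
    rw [← sub_eq_zero, ← intervalIntegral.integral_sub hi1 hi2]
    have hee' : ∀ θ, HasDerivAt e (e θ * Complex.I) θ := by
      intro θ
      simpa [he] using hasDerivAt_circleMap 0 1 θ
    -- The function differentiated is `-ρ⁻¹ ∂_θ G`, written as a directional derivative so that `ρ =
    -- 0` needs no separate treatment.
    have hder : ∀ θ ∈ Set.uIcc (-Real.pi) Real.pi,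
        HasDerivAt (fun θ => - fderiv ℝ G (circleMap 0 ρ θ) (e θ * Complex.I))
          (δ ρ θ - ρ * Δ G (circleMap 0 ρ θ)) θ := by
      intro θ _
      have h1 : HasDerivAt (circleMap 0 ρ) (ρ • (e θ * Complex.I)) θ := by
        have := hasDerivAt_circleMap 0 ρ θ
        rwa [hee, mul_assoc, ← Complex.real_smul] at this
      have h2 := hasDerivAt_clm_comp_apply (hd2 _ (hmem ρ hρ θ)) h1
        ((hee' θ).mul_const Complex.I)
      refine h2.neg.congr_deriv ?_
      have h3 := bilinear_add_bilinear_mul_I (fderiv ℝ (fderiv ℝ G) (circleMap 0 ρ θ)) (e θ)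
      rw [he1, one_pow, one_mul, ← laplacian_eq_fderiv_fderiv] at h3
      rw [← h3]
      simp only [hδ, map_smul, smul_apply, smul_eq_mul, mul_assoc,
        Complex.I_mul_I, mul_neg, mul_one, map_neg]
      ring
    rw [intervalIntegral.integral_eq_sub_of_hasDerivAt hder (hi1.sub hi2)]
    have hper : ∀ ρ, circleMap 0 ρ (-Real.pi) = circleMap 0 ρ Real.pi := by
      intro ρ
      have := periodic_circleMap 0 ρ (-Real.pi)
      rw [← this]; congr 1; ring
    simp only [he, hper, sub_self]
  have hswap : ∫ ρ in (0 : ℝ)..r, ∫ θ in (-Real.pi)..Real.pi, Real.log (r / ρ) * δ ρ θ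
      = ∫ θ in (-Real.pi)..Real.pi, ∫ ρ in (0 : ℝ)..r, Real.log (r / ρ) * δ ρ θ := by
    refine intervalIntegral_intervalIntegral_swap ?_
    rw [Set.uIoc_of_le hr.le, Set.uIoc_of_le hπ]
    refine IntegrableOn.mono_set (t := (Set.Icc 0 r ×ˢ Set.Icc (-Real.pi) Real.pi)) ?_ (Set.prod_mono Set.Ioc_subset_Icc_self
      Set.Ioc_subset_Icc_self)
    refine IntegrableOn.mul_continuousOn (g := fun p : ℝ × ℝ => Real.log (r / p.1)) ?_ hδK hK
    have h1 : IntegrableOn (fun ρ => Real.log (r / ρ)) (Set.Icc 0 r) := by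
      rw [integrableOn_Icc_iff_integrableOn_Ioc,
        ← intervalIntegrable_iff_integrableOn_Ioc_of_le hr.le]
      exact intervalIntegrable_log_div hr
    have h2 : IntegrableOn (fun _ : ℝ => (1 : ℝ)) (Set.Icc (-Real.pi) Real.pi) :=
      continuousOn_const.integrableOn_compact isCompact_Icc
    have := Integrable.mul_prod h1 h2
    rw [Measure.prod_restrict, ← Measure.volume_eq_prod] at this
    simpa only [IntegrableOn, mul_one] using this
  have hGi : IntervalIntegrable (fun θ => G (circleMap 0 r θ)) volume (-Real.pi) Real.pi :=
    (hGc.comp (by fun_prop) fun θ _ => hmem r ⟨hr.le, le_rfl⟩ θ).intervalIntegrable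
  have hpolar := setIntegral_ball_eq_polar (f := fun z => Real.log (r / ‖z‖) * Δ G z) hr ?_
  · have h1 : ∀ ρ ∈ Set.uIcc 0 r, ∫ θ in (-Real.pi)..Real.pi,
        ρ * (Real.log (r / ‖circleMap 0 ρ θ‖) * Δ G (circleMap 0 ρ θ))
        = ∫ θ in (-Real.pi)..Real.pi, Real.log (r / ρ) * δ ρ θ := by
      intro ρ hρ
      rw [Set.uIcc_of_le hr.le] at hρ
      rw [intervalIntegral.integral_const_mul (Real.log (r / ρ)), hang ρ hρ,
        ← intervalIntegral.integral_const_mul]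
      refine intervalIntegral.integral_congr fun θ _ => ?_
      simp [abs_of_nonneg hρ.1]
      ring
    rw [hpolar, intervalIntegral.integral_congr h1, hswap,
      intervalIntegral.integral_congr (g := fun θ => G (circleMap 0 r θ) - G 0)
        (fun θ hθ => hrad θ (by rwa [Set.uIcc_of_le hπ] at hθ)),
      intervalIntegral.integral_sub hGi intervalIntegrable_const,
      intervalIntegral.integral_const, Real.circleAverage_eq_integral_add (-Real.pi),
      intervalIntegral.integral_comp_add_right (fun θ => G (circleMap 0 r θ))]
    have h2 : (0 : ℝ) + -Real.pi = -Real.pi := by ring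
    have h3 : 2 * Real.pi + -Real.pi = Real.pi := by ring
    rw [h2, h3, mul_sub]
    simp only [smul_eq_mul]
    field_simp
    ring
  · have h1 : ∀ p ∈ (Set.Icc 0 r ×ˢ Set.Icc (-Real.pi) Real.pi), (Real.log r * p.1 - p.1 * Real.log p.1) * Δ G (circleMap 0 p.1 p.2)
        = p.1 * (Real.log (r / ‖circleMap 0 p.1 p.2‖) * Δ G (circleMap 0 p.1 p.2)) := by
      rintro ⟨ρ, θ⟩ ⟨hρ, -⟩
      simp only [norm_circleMap_zero, abs_of_nonneg hρ.1]
      rcases hρ.1.eq_or_lt with h | h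
      · simp only at h
        simp [← h]
      · rw [Real.log_div hr.ne' h.ne']; ring
    refine ContinuousOn.congr ?_ fun p hp => (h1 p hp).symm
    refine ContinuousOn.mul ?_ hLK
    exact ((continuous_const.mul continuous_fst).sub
      (Real.continuous_mul_log.comp continuous_fst)).continuousOn

/-! ### Radial measures on the disc -/

/-- The measure on the disc with density `p |z|` with respect to Lebesgue measure. -/
def radialMeasure (p : ℝ → ℝ≥0∞) : Measure ℂ :=
  (volume.restrict (ball (0 : ℂ) 1)).withDensity fun z => p ‖z‖

instance (p : ℝ → ℝ≥0∞) : SFinite (radialMeasure p) := by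
  unfold radialMeasure; infer_instance

theorem radialMeasure_absolutelyContinuous (p : ℝ → ℝ≥0∞) :
    radialMeasure p ≪ volume.restrict (ball (0 : ℂ) 1) :=
  withDensity_absolutelyContinuous _ _

theorem ae_radialMeasure_mem_ball (p : ℝ → ℝ≥0∞) : ∀ᵐ z ∂radialMeasure p, z ∈ ball (0 : ℂ) 1 :=
  (radialMeasure_absolutelyContinuous p).ae_le (ae_restrict_mem measurableSet_ball)

theorem ae_radialMeasure_ne_zero (p : ℝ → ℝ≥0∞) : ∀ᵐ z ∂radialMeasure p, z ≠ 0 := by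
  refine (radialMeasure_absolutelyContinuous p).ae_le (ae_restrict_of_ae ?_)
  exact Measure.ae_ne volume 0

theorem lintegral_radialMeasure {p : ℝ → ℝ≥0∞} (hp : Measurable p) {f : ℂ → ℝ≥0∞}
    (hf : Measurable f) :
    ∫⁻ z, f z ∂radialMeasure p = ∫⁻ z in ball (0 : ℂ) 1, p ‖z‖ * f z := by
  unfold radialMeasure
  rw [lintegral_withDensity_eq_lintegral_mul _ (by fun_prop) hf]
  rfl

theorem lintegral_radialMeasure_norm {p f : ℝ → ℝ≥0∞} (hp : Measurable p) (hf : Measurable f) :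
    ∫⁻ z, f ‖z‖ ∂radialMeasure p
      = ENNReal.ofReal (2 * Real.pi) * ∫⁻ ρ in Set.Ioo 0 1, ENNReal.ofReal ρ * (p ρ * f ρ) := by
  rw [lintegral_radialMeasure hp (by fun_prop),
    setLIntegral_ball_eq_polar (f := fun ρ => p ρ * f ρ) (by fun_prop)]

theorem measurePreserving_rotation_radialMeasure {p : ℝ → ℝ≥0∞} (hp : Measurable p) (θ : Circle) :
    MeasurePreserving (rotation θ) (radialMeasure p) (radialMeasure p) := by
  have hm : Measurable (rotation θ) := (rotation θ).continuous.measurable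
  refine ⟨hm, ?_⟩
  refine Measure.ext_of_lintegral _ fun f hf => ?_
  rw [lintegral_map hf hm, lintegral_radialMeasure hp hf,
    lintegral_radialMeasure (f := fun z => f (rotation θ z)) hp (hf.comp hm)]
  have h1 : rotation θ ⁻¹' ball 0 1 = ball (0 : ℂ) 1 := by
    ext u
    rw [Set.mem_preimage, mem_ball_zero_iff, mem_ball_zero_iff, LinearIsometryEquiv.norm_map]
  have h2 := (rotation θ).measurePreserving.setLIntegral_comp_preimage_emb
    (rotation θ).toHomeomorph.measurableEmbedding (fun z => p ‖z‖ * f z) (ball (0 : ℂ) 1)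
  rw [h1] at h2
  rw [← h2]
  simp only [LinearIsometryEquiv.norm_map]

theorem circleAverage_norm_eq {E : Type*} [NormedAddCommGroup E] [NormedSpace ℝ E] (F : ℂ → E)
    (u : ℂ) :
    Real.circleAverage F 0 ‖u‖
      = (2 * Real.pi)⁻¹ • ∫ θ in (0 : ℝ)..2 * Real.pi, F (rotation (Circle.exp θ) u) := by
  rw [Real.circleAverage_eq_integral_add (Complex.arg u)]
  congr 2
  ext θ
  congr 1
  rw [circleMap_zero, rotation_apply, Circle.coe_exp]
  conv_rhs => rw [← Complex.norm_mul_exp_arg_mul_I u]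
  push_cast
  rw [add_mul, Complex.exp_add]
  ring

/-- The measure is invariant under rotations, so the integral equals its average over all rotated
copies of `F`; Fubini moves that average inside, where it becomes a circle average. -/
theorem integral_radialMeasure_eq_circleAverage {E : Type*} [NormedAddCommGroup E]
    [NormedSpace ℝ E] [CompleteSpace E] {p : ℝ → ℝ≥0∞} (hp : Measurable p) {F : ℂ → E}
    (hF : ContinuousOn F (ball 0 1)) (hi : Integrable F (radialMeasure p)) :
    Integrable (fun u => Real.circleAverage F 0 ‖u‖) (radialMeasure p) ∧
      ∫ u, F u ∂radialMeasure p = ∫ u, Real.circleAverage F 0 ‖u‖ ∂radialMeasure p := by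
  have hmp := fun θ : ℝ => measurePreserving_rotation_radialMeasure hp (Circle.exp θ)
  have hrot : ∀ θ : ℝ, ∫ u, F (rotation (Circle.exp θ) u) ∂radialMeasure p
      = ∫ u, F u ∂radialMeasure p := fun θ =>
    (hmp θ).integral_comp (rotation (Circle.exp θ)).toHomeomorph.measurableEmbedding F
  have hrotn : ∀ θ : ℝ, ∫ u, ‖F (rotation (Circle.exp θ) u)‖ ∂radialMeasure p
      = ∫ u, ‖F u‖ ∂radialMeasure p := fun θ =>
    (hmp θ).integral_comp (rotation (Circle.exp θ)).toHomeomorph.measurableEmbedding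
      fun u => ‖F u‖
  have hmeas : AEStronglyMeasurable
      (Function.uncurry fun (θ : ℝ) (u : ℂ) => F (rotation (Circle.exp θ) u))
      ((volume.restrict (Set.uIoc 0 (2 * Real.pi))).prod (radialMeasure p)) := by
    have hac : (volume.restrict (Set.uIoc 0 (2 * Real.pi))).prod (radialMeasure p) ≪
        (volume.restrict (Set.uIoc 0 (2 * Real.pi))).prod (volume.restrict (ball (0 : ℂ) 1)) :=
      Measure.AbsolutelyContinuous.rfl.prod (radialMeasure_absolutelyContinuous p)
    refine AEStronglyMeasurable.mono_ac hac ?_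
    rw [Measure.prod_restrict]
    refine ContinuousOn.aestronglyMeasurable ?_ (measurableSet_uIoc.prod measurableSet_ball)
    refine hF.comp ?_ ?_
    · simp only [rotation_apply, Circle.coe_exp]
      fun_prop
    · rintro ⟨θ, u⟩ ⟨-, hu⟩
      simpa using hu
  have hint : Integrable (Function.uncurry fun (θ : ℝ) (u : ℂ) => F (rotation (Circle.exp θ) u))
      ((volume.restrict (Set.uIoc 0 (2 * Real.pi))).prod (radialMeasure p)) := by
    rw [integrable_prod_iff hmeas]
    refine ⟨Eventually.of_forall fun θ => ?_, ?_⟩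
    · exact (hmp θ).integrable_comp_of_integrable hi
    · simp only [Function.uncurry, hrotn]
      exact continuous_const.integrableOn_uIoc
  have hfub := intervalIntegral_integral_swap hint
  simp only [hrot, intervalIntegral.integral_const, sub_zero] at hfub
  have hint2 := hint.integral_prod_right
  simp only [circleAverage_norm_eq]
  rw [integral_smul, ← hfub, smul_smul, inv_mul_cancel₀ (by positivity), one_smul]
  refine ⟨Integrable.smul _ ?_, rfl⟩
  have h2π : (0 : ℝ) ≤ 2 * Real.pi := by positivity
  simpa only [intervalIntegral.integral_of_le h2π, Set.uIoc_of_le h2π, Function.uncurry]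
    using hint2

/-- A nonnegative derivative of a function continuous up to the endpoints is automatically
integrable. Radial integrals with a singularity at `ρ = 1` thus reduce to exhibiting an
antiderivative. -/
theorem setLIntegral_Ioo_eq_of_hasDerivAt {f f' : ℝ → ℝ} {a b : ℝ} (hab : a ≤ b)
    (hf : ContinuousOn f (Set.Icc a b)) (hf' : ∀ x ∈ Set.Ioo a b, HasDerivAt f (f' x) x)
    (h0 : ∀ x ∈ Set.Ioo a b, 0 ≤ f' x) :
    ∫⁻ x in Set.Ioo a b, ENNReal.ofReal (f' x) = ENNReal.ofReal (f b - f a) := by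
  have h1 : IntegrableOn f' (Set.Ioc a b) := intervalIntegral.integrableOn_deriv_of_nonneg hf hf' h0
  rw [← intervalIntegral.integral_eq_sub_of_hasDerivAt_of_le hab hf hf'
    ((intervalIntegrable_iff_integrableOn_Ioc_of_le hab).2 h1),
    intervalIntegral.integral_of_le hab, integral_Ioc_eq_integral_Ioo,
    ofReal_integral_eq_lintegral_ofReal (h1.mono_set Set.Ioo_subset_Ioc_self)]
  filter_upwards [ae_restrict_mem measurableSet_Ioo] with x hx using h0 x hx

/-- The radial density of `λ_t`. -/
def weight (t ρ : ℝ) : ℝ≥0∞ := ENNReal.ofReal ((t + 1) / Real.pi * (1 - ρ ^ 2) ^ t)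

theorem measurable_weight (t : ℝ) : Measurable (weight t) := by
  unfold weight; fun_prop

theorem weightedMeasure_eq_radialMeasure (t : ℝ) : weightedMeasure t = radialMeasure (weight t) :=
  rfl

theorem hasDerivAt_one_sub_sq (ρ : ℝ) : HasDerivAt (fun ρ : ℝ => 1 - ρ ^ 2) (-(2 * ρ)) ρ := by
  simpa using ((hasDerivAt_id ρ).pow 2).const_sub 1

theorem continuous_rpow_mul_log {s : ℝ} (hs : 0 < s) :
    ContinuousOn (fun x : ℝ => x ^ s * Real.log x) (Set.Ici 0) := by
  have h1 : ContinuousOn (fun x : ℝ => s⁻¹ * (x ^ s * Real.log (x ^ s))) (Set.Ici 0) :=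
    continuousOn_const.mul (Real.continuous_mul_log.comp
      (Real.continuous_rpow_const hs.le)).continuousOn
  refine h1.congr fun x hx => ?_
  rcases (Set.mem_Ici.1 hx).eq_or_lt with rfl | hx
  · simp [Real.zero_rpow hs.ne']
  · simp only
    rw [Real.log_rpow hx]; field_simp

theorem isProbabilityMeasure_weightedMeasure {t : ℝ} (ht : -1 < t) :
    IsProbabilityMeasure (weightedMeasure t) := by
  have ht1 : 0 < t + 1 := by linarith
  constructor
  rw [← lintegral_one, weightedMeasure_eq_radialMeasure,
    lintegral_radialMeasure_norm (f := fun _ => 1) (measurable_weight t) measurable_const]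
  have h1 : ∀ ρ ∈ Set.Ioo (0 : ℝ) 1, ENNReal.ofReal ρ * (weight t ρ * 1)
      = ENNReal.ofReal (ρ * ((t + 1) / Real.pi * (1 - ρ ^ 2) ^ t)) := by
    intro ρ hρ
    rw [mul_one, weight, ← ENNReal.ofReal_mul hρ.1.le]
  rw [setLIntegral_congr_fun measurableSet_Ioo h1,
    setLIntegral_Ioo_eq_of_hasDerivAt (f := fun ρ => -(2 * Real.pi)⁻¹ * (1 - ρ ^ 2) ^ (t + 1))
      zero_le_one]
  · rw [← ENNReal.ofReal_mul (by positivity)]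
    simp only [one_pow, sub_self, Real.zero_rpow ht1.ne']
    rw [← ENNReal.ofReal_one]
    congr 1
    simp
    field_simp
  · exact continuousOn_const.mul (ContinuousOn.rpow_const (by fun_prop) fun _ _ => Or.inr ht1.le)
  · intro ρ hρ
    have h2 : 0 < 1 - ρ ^ 2 := by nlinarith [hρ.1, hρ.2]
    refine (((hasDerivAt_one_sub_sq ρ).rpow_const (p := t + 1) (Or.inl h2.ne')).const_mul
      _).congr_deriv ?_
    rw [add_sub_cancel_right]
    field_simp
  · intro ρ hρ
    have h2 : 0 < 1 - ρ ^ 2 := by nlinarith [hρ.1, hρ.2]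
    have := hρ.1
    positivity

/-- With `u = 1 - ρ²` this is `(t + 1) ∫₀¹ u^t (-log u) du`. It fixes the total mass of the Green
potential. -/
theorem lintegral_neg_log_weightedMeasure {t : ℝ} (ht : -1 < t) :
    ∫⁻ z, ENNReal.ofReal (-Real.log (1 - ‖z‖ ^ 2)) ∂weightedMeasure t
      = ENNReal.ofReal (1 / (t + 1)) := by
  have ht1 : 0 < t + 1 := by linarith
  rw [weightedMeasure_eq_radialMeasure,
    lintegral_radialMeasure_norm (f := fun ρ => ENNReal.ofReal (-Real.log (1 - ρ ^ 2)))
      (measurable_weight t) (by fun_prop)]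
  have h1 : ∀ ρ ∈ Set.Ioo (0 : ℝ) 1,
      ENNReal.ofReal ρ * (weight t ρ * ENNReal.ofReal (-Real.log (1 - ρ ^ 2)))
      = ENNReal.ofReal (ρ * ((t + 1) / Real.pi * (1 - ρ ^ 2) ^ t * -Real.log (1 - ρ ^ 2))) := by
    intro ρ hρ
    have h2 : 0 < 1 - ρ ^ 2 := by nlinarith [hρ.1, hρ.2]
    rw [weight, ← ENNReal.ofReal_mul (by positivity), ← ENNReal.ofReal_mul hρ.1.le]
  rw [setLIntegral_congr_fun measurableSet_Ioo h1,
    setLIntegral_Ioo_eq_of_hasDerivAt (f := fun ρ => (2 * Real.pi)⁻¹ *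
      ((1 - ρ ^ 2) ^ (t + 1) * Real.log (1 - ρ ^ 2) - (1 - ρ ^ 2) ^ (t + 1) / (t + 1)))
      zero_le_one]
  · rw [← ENNReal.ofReal_mul (by positivity)]
    simp only [one_pow, sub_self, Real.zero_rpow ht1.ne']
    congr 1
    simp
    field_simp
  · have h3 : Set.MapsTo (fun ρ : ℝ => 1 - ρ ^ 2) (Set.Icc 0 1) (Set.Ici 0) := by
      intro ρ hρ
      simp only [Set.mem_Ici]
      nlinarith [hρ.1, hρ.2]
    refine continuousOn_const.mul (ContinuousOn.sub ?_ ?_)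
    · exact (continuous_rpow_mul_log ht1).comp (by fun_prop) h3
    · exact (ContinuousOn.rpow_const (by fun_prop) fun _ _ => Or.inr ht1.le).div_const _
  · intro ρ hρ
    have h2 : 0 < 1 - ρ ^ 2 := by nlinarith [hρ.1, hρ.2]
    have h3 := (hasDerivAt_one_sub_sq ρ).rpow_const (p := t + 1) (Or.inl h2.ne')
    refine (((h3.mul ((hasDerivAt_one_sub_sq ρ).log h2.ne')).sub (h3.div_const _)).const_mul
      _).congr_deriv ?_
    rw [add_sub_cancel_right, Real.rpow_add_one h2.ne']
    field_simp
    ring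
  · intro ρ hρ
    have h2 : 0 < 1 - ρ ^ 2 := by nlinarith [hρ.1, hρ.2]
    have h3 : Real.log (1 - ρ ^ 2) ≤ 0 := Real.log_nonpos h2.le (by nlinarith [hρ.1])
    have := hρ.1
    have h4 : 0 ≤ -Real.log (1 - ρ ^ 2) := by linarith
    positivity

/-! ### The radial Green potential of `λ_t` -/

/-- The radial density of the Möbius invariant measure. -/
def invWeight (ρ : ℝ) : ℝ≥0∞ := ENNReal.ofReal (((1 - ρ ^ 2) ^ 2)⁻¹)

theorem measurable_invWeight : Measurable invWeight := by
  unfold invWeight; fun_prop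

/-- The Möbius invariant measure `dm(z) / (1 - |z|²)²` on the disc. -/
def invMeasure : Measure ℂ := radialMeasure invWeight

instance : SFinite invMeasure := by unfold invMeasure; infer_instance

/-- The function `z ↦ (1 / 2π) ∫ log⁺ (|ξ| / |z|) dλ_t(ξ)`, as a function of `|z|`. -/
def greenPotential (t ρ : ℝ) : ℝ≥0∞ :=
  ∫⁻ ξ, ENNReal.ofReal ((2 * Real.pi)⁻¹ * Real.posLog (‖ξ‖ / ρ)) ∂weightedMeasure t

instance (t : ℝ) : SFinite (weightedMeasure t) := by
  rw [weightedMeasure_eq_radialMeasure]; infer_instance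

theorem measurable_posLog_div :
    Measurable fun p : ℝ × ℂ => ENNReal.ofReal ((2 * Real.pi)⁻¹ * Real.posLog (‖p.2‖ / p.1)) := by
  fun_prop

theorem measurable_greenPotential (t : ℝ) : Measurable (greenPotential t) :=
  measurable_posLog_div.lintegral_prod_right'

theorem greenPotential_lt_top {t : ℝ} (ht : -1 < t) {ρ : ℝ} (hρ : 0 < ρ) :
    greenPotential t ρ < ∞ := by
  have := isProbabilityMeasure_weightedMeasure ht
  have h1 : greenPotential t ρ
      ≤ ∫⁻ _, ENNReal.ofReal ((2 * Real.pi)⁻¹ * Real.posLog (1 / ρ)) ∂weightedMeasure t := by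
    refine lintegral_mono_ae ?_
    filter_upwards [ae_radialMeasure_mem_ball (weight t)] with ξ hξ
    have hξ' : ‖ξ‖ ≤ 1 := by simpa using (mem_ball_zero_iff.1 hξ).le
    refine ENNReal.ofReal_le_ofReal (mul_le_mul_of_nonneg_left ?_ (by positivity))
    exact Real.posLog_le_posLog (by positivity) (by gcongr)
  refine h1.trans_lt ?_
  simp

/-- The function `γ = -(1/4) log (1 - ρ²)` satisfies `(ρ γ')' = ρ / (1 - ρ²)²`, the polar density of
the invariant measure, so the one-variable Jensen formula evaluates the integral. -/
theorem lintegral_posLog_invMeasure {r : ℝ} (hr0 : 0 < r) (hr : r < 1) :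
    ∫⁻ z, ENNReal.ofReal ((2 * Real.pi)⁻¹ * Real.posLog (r / ‖z‖)) ∂invMeasure
      = ENNReal.ofReal (4⁻¹ * -Real.log (1 - r ^ 2)) := by
  have hpos : ∀ ρ ∈ Set.Icc 0 r, 0 < 1 - ρ ^ 2 := fun ρ hρ => by nlinarith [hρ.1, hρ.2]
  have hlog : ∀ ρ ∈ Set.Ioo 0 r, 0 ≤ Real.log (r / ρ) := fun ρ hρ =>
    Real.log_nonneg (by rw [le_div_iff₀ hρ.1]; linarith [hρ.2])
  rw [invMeasure, lintegral_radialMeasure_norm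
    (f := fun ρ => ENNReal.ofReal ((2 * Real.pi)⁻¹ * Real.posLog (r / ρ))) measurable_invWeight
    (by fun_prop)]
  have h1 : ∀ ρ ∈ Set.Ioo (0 : ℝ) 1, ENNReal.ofReal ρ *
      (invWeight ρ * ENNReal.ofReal ((2 * Real.pi)⁻¹ * Real.posLog (r / ρ)))
      = (Set.Ioo 0 r).indicator (fun ρ => ENNReal.ofReal
        ((2 * Real.pi)⁻¹ * (Real.log (r / ρ) * (ρ / (1 - ρ ^ 2) ^ 2)))) ρ := by
    intro ρ hρ
    by_cases h : ρ < r
    · have h2 : 1 ≤ r / ρ := by rw [le_div_iff₀ hρ.1]; linarith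
      rw [Set.indicator_of_mem (Set.mem_Ioo.2 ⟨hρ.1, h⟩), Real.posLog_eq_log (h2.trans (le_abs_self _)), invWeight,
        ← ENNReal.ofReal_mul (by positivity), ← ENNReal.ofReal_mul hρ.1.le]
      congr 1
      ring
    · have h2 : Real.posLog (r / ρ) = 0 := by
        rw [Real.posLog_eq_zero_iff, abs_of_nonneg (div_nonneg hr0.le hρ.1.le),
          div_le_one hρ.1]
        linarith
      rw [Set.indicator_of_notMem (fun h' => h h'.2), h2]
      simp
  have hγd : ∀ ρ ∈ Set.Icc 0 r, HasDerivAt (fun ρ => -4⁻¹ * Real.log (1 - ρ ^ 2))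
      (2⁻¹ * (ρ / (1 - ρ ^ 2))) ρ := by
    intro ρ hρ
    refine (((hasDerivAt_one_sub_sq ρ).log (hpos ρ hρ).ne').const_mul _).congr_deriv ?_
    ring
  have hint := integral_log_mul_eq_sub (γ := fun ρ => -4⁻¹ * Real.log (1 - ρ ^ 2))
    (γ' := fun ρ => 2⁻¹ * (ρ / (1 - ρ ^ 2))) (δ := fun ρ => ρ / (1 - ρ ^ 2) ^ 2) hr0
    (fun ρ hρ => (hγd ρ hρ).continuousAt.continuousWithinAt)
    (fun ρ hρ => hγd ρ (Set.Ioo_subset_Icc_self hρ)) ?_ ?_ ?_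
  · rw [setLIntegral_congr_fun measurableSet_Ioo h1, setLIntegral_indicator measurableSet_Ioo,
      Set.inter_eq_left.2 (Set.Ioo_subset_Ioo_right hr.le)]
    have hδi : ContinuousOn (fun ρ : ℝ => ρ / (1 - ρ ^ 2) ^ 2) (Set.uIcc 0 r) := by
      rw [Set.uIcc_of_le hr0.le]
      exact continuousOn_id.div (by fun_prop) fun ρ hρ => pow_ne_zero _ (hpos ρ hρ).ne'
    have hii := ((intervalIntegrable_log_div hr0).mul_continuousOn hδi).const_mul (2 * Real.pi)⁻¹
    rw [intervalIntegrable_iff_integrableOn_Ioc_of_le hr0.le,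
      integrableOn_Ioc_iff_integrableOn_Ioo] at hii
    rw [← ofReal_integral_eq_lintegral_ofReal hii, ← integral_Ioc_eq_integral_Ioo,
      ← intervalIntegral.integral_of_le hr0.le, intervalIntegral.integral_const_mul, hint,
      ← ENNReal.ofReal_mul (by positivity)]
    · congr 1
      simp
      field_simp
    · filter_upwards [ae_restrict_mem measurableSet_Ioo] with ρ hρ
      have := hlog ρ hρ
      have := hρ.1.le
      simp only [Pi.zero_apply]
      positivity
  · exact continuousOn_const.mul (continuousOn_id.div (by fun_prop) fun ρ hρ => (hpos ρ hρ).ne')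
  · intro ρ hρ
    have h2 := hpos ρ (Set.Ioo_subset_Icc_self hρ)
    refine ((hasDerivAt_id ρ).mul (((hasDerivAt_id ρ).div (hasDerivAt_one_sub_sq ρ)
      h2.ne').const_mul 2⁻¹)).congr_deriv ?_
    simp only [id, Pi.div_apply]
    field_simp
    ring
  · exact continuousOn_id.div (by fun_prop) fun ρ hρ => pow_ne_zero _ (hpos ρ hρ).ne'

/-- Tonelli combines the two preceding logarithmic integrals. The factor `1 / (t + 1)` later cancels
the `t + 1` in the density of `λ_t`, which is why the final bound does not depend on `t`. -/
theorem lintegral_greenPotential_invMeasure {t : ℝ} (ht : -1 < t) :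
    ∫⁻ z, greenPotential t ‖z‖ ∂invMeasure = ENNReal.ofReal (1 / (4 * (t + 1))) := by
  unfold greenPotential
  have hm : Measurable (Function.uncurry fun z ξ : ℂ =>
      ENNReal.ofReal ((2 * Real.pi)⁻¹ * Real.posLog (‖ξ‖ / ‖z‖))) := by
    unfold Function.uncurry
    fun_prop
  rw [lintegral_lintegral_swap hm.aemeasurable]
  have h1 : ∀ᵐ ξ ∂weightedMeasure t,
      ∫⁻ z, ENNReal.ofReal ((2 * Real.pi)⁻¹ * Real.posLog (‖ξ‖ / ‖z‖)) ∂invMeasure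
        = ENNReal.ofReal 4⁻¹ * ENNReal.ofReal (-Real.log (1 - ‖ξ‖ ^ 2)) := by
    rw [weightedMeasure_eq_radialMeasure]
    filter_upwards [ae_radialMeasure_mem_ball (weight t), ae_radialMeasure_ne_zero (weight t)]
      with ξ h1 h2
    rw [lintegral_posLog_invMeasure (norm_pos_iff.2 h2) (mem_ball_zero_iff.1 h1),
      ENNReal.ofReal_mul (by positivity)]
  rw [lintegral_congr_ae h1, lintegral_const_mul _ (by fun_prop),
    lintegral_neg_log_weightedMeasure ht, ← ENNReal.ofReal_mul (by positivity)]
  congr 1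
  field_simp

theorem volume_restrict_le_invMeasure : volume.restrict (ball (0 : ℂ) 1) ≤ invMeasure := by
  refine Measure.le_intro fun s hs _ => ?_
  rw [invMeasure, radialMeasure, withDensity_apply _ hs, ← setLIntegral_one]
  refine lintegral_mono_ae (ae_restrict_of_ae ?_)
  filter_upwards [ae_restrict_mem measurableSet_ball] with z hz
  have h1 : ‖z‖ < 1 := mem_ball_zero_iff.1 hz
  have h2 : 0 < 1 - ‖z‖ ^ 2 := by nlinarith [norm_nonneg z]
  rw [invWeight, ENNReal.one_le_ofReal]
  refine (one_le_inv₀ (by positivity)).2 (pow_le_one₀ h2.le (by nlinarith [norm_nonneg z]))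

theorem lintegral_greenPotential_lt_top {t : ℝ} (ht : -1 < t) :
    ∫⁻ z in ball (0 : ℂ) 1, greenPotential t ‖z‖ < ∞ := by
  refine (lintegral_mono' volume_restrict_le_invMeasure le_rfl).trans_lt ?_
  rw [lintegral_greenPotential_invMeasure ht]
  exact ENNReal.ofReal_lt_top

/-! ### Green's formula for means against `λ_t`. -/

theorem setIntegral_ball_norm_log_eq {G : ℂ → ℝ} {ξ : ℂ} (hξ : ‖ξ‖ < 1) :
    ∫ z in ball (0 : ℂ) ‖ξ‖, Real.log (‖ξ‖ / ‖z‖) * G z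
      = ∫ z in ball (0 : ℂ) 1, Real.posLog (‖ξ‖ / ‖z‖) * G z := by
  have h1 : ∀ᵐ z ∂(volume.restrict (ball (0 : ℂ) 1)),
      (ball (0 : ℂ) ‖ξ‖).indicator (fun z => Real.log (‖ξ‖ / ‖z‖) * G z) z
        = Real.posLog (‖ξ‖ / ‖z‖) * G z := by
    refine ae_restrict_of_ae ?_
    filter_upwards [Measure.ae_ne volume (0 : ℂ)] with z hz
    have hz' : 0 < ‖z‖ := norm_pos_iff.2 hz
    by_cases h : ‖z‖ < ‖ξ‖
    · have h2 : 1 ≤ ‖ξ‖ / ‖z‖ := by rw [le_div_iff₀ hz']; linarith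
      rw [Set.indicator_of_mem (mem_ball_zero_iff.2 h),
        Real.posLog_eq_log (h2.trans (le_abs_self _))]
    · have h2 : Real.posLog (‖ξ‖ / ‖z‖) = 0 := by
        rw [Real.posLog_eq_zero_iff, abs_of_nonneg (by positivity), div_le_one hz']
        linarith
      rw [Set.indicator_of_notMem (fun h' => h (mem_ball_zero_iff.1 h')), h2, zero_mul]
  rw [← integral_congr_ae h1, setIntegral_indicator measurableSet_ball,
    Set.inter_eq_right.2 (ball_subset_ball hξ.le)]

/-- Jensen's formula on the circle of radius `|ξ|` is averaged over `λ_t` in `ξ`. Writing the kernel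
with `log⁺` puts all radii on the same disc, and the bound on the Laplacian together with the finite
integral of the potential justifies Fubini. -/
theorem integral_weightedMeasure_sub_eq_laplacian {t : ℝ} (ht : -1 < t) {G : ℂ → ℝ}
    (hG : ContDiffOn ℝ 2 G (ball 0 1)) (hGi : Integrable G (weightedMeasure t)) {L : ℝ}
    (hL : ∀ z ∈ ball (0 : ℂ) 1, |Δ G z| ≤ L) :
    ∫ z, G z ∂weightedMeasure t - G 0
      = ∫ z in ball (0 : ℂ) 1, Δ G z * (greenPotential t ‖z‖).toReal := by
  have hprob := isProbabilityMeasure_weightedMeasure ht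
  have hGd : ContinuousOn (Δ G) (ball 0 1) := continuousOn_laplacian hG
  obtain ⟨hci, hcirc⟩ := integral_radialMeasure_eq_circleAverage (measurable_weight t)
    hG.continuousOn hGi
  rw [← weightedMeasure_eq_radialMeasure] at hcirc hci
  have h1 : ∀ᵐ ξ ∂weightedMeasure t, Real.circleAverage G 0 ‖ξ‖ - G 0
      = ∫ z in ball (0 : ℂ) 1, (2 * Real.pi)⁻¹ * Real.posLog (‖ξ‖ / ‖z‖) * Δ G z := by
    rw [weightedMeasure_eq_radialMeasure]
    filter_upwards [ae_radialMeasure_mem_ball (weight t), ae_radialMeasure_ne_zero (weight t)]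
      with ξ h1 h2
    have h1' := mem_ball_zero_iff.1 h1
    rw [circleAverage_sub_eq_integral_laplacian (norm_pos_iff.2 h2) h1' hG,
      setIntegral_ball_norm_log_eq h1', ← integral_const_mul]
    simp only [mul_assoc]
  have hmk : Measurable fun p : ℂ × ℂ => (2 * Real.pi)⁻¹ * Real.posLog (‖p.1‖ / ‖p.2‖) := by
    fun_prop
  have hk : Integrable (fun p : ℂ × ℂ => (2 * Real.pi)⁻¹ * Real.posLog (‖p.1‖ / ‖p.2‖))
      ((weightedMeasure t).prod (volume.restrict (ball (0 : ℂ) 1))) := by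
    refine ⟨hmk.aestronglyMeasurable, ?_⟩
    rw [hasFiniteIntegral_iff_ofReal (Eventually.of_forall fun p =>
      mul_nonneg (by positivity) Real.posLog_nonneg), lintegral_prod_symm _ (by fun_prop)]
    exact lintegral_greenPotential_lt_top ht
  have hint : Integrable (fun p : ℂ × ℂ => (2 * Real.pi)⁻¹ * Real.posLog (‖p.1‖ / ‖p.2‖) * Δ G p.2)
      ((weightedMeasure t).prod (volume.restrict (ball (0 : ℂ) 1))) := by
    refine hk.mul_bdd (c := L) ?_ ?_
    · exact (hGd.aestronglyMeasurable measurableSet_ball).comp_snd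
    · have h2 : ∀ᵐ z ∂(volume.restrict (ball (0 : ℂ) 1)), ‖Δ G z‖ ≤ L := by
        filter_upwards [ae_restrict_mem measurableSet_ball] with z hz using hL z hz
      exact Measure.quasiMeasurePreserving_snd.ae h2
  calc ∫ z, G z ∂weightedMeasure t - G 0
      = ∫ ξ, (Real.circleAverage G 0 ‖ξ‖ - G 0) ∂weightedMeasure t := by
        rw [hcirc, integral_sub hci (integrable_const _)]
        simp
    _ = ∫ ξ, (∫ z in ball (0 : ℂ) 1, (2 * Real.pi)⁻¹ * Real.posLog (‖ξ‖ / ‖z‖) * Δ G z)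
          ∂weightedMeasure t := integral_congr_ae h1
    _ = ∫ z in ball (0 : ℂ) 1, ∫ ξ, (2 * Real.pi)⁻¹ * Real.posLog (‖ξ‖ / ‖z‖) * Δ G z
          ∂weightedMeasure t := integral_integral_swap hint
    _ = _ := by
        refine integral_congr_ae (Eventually.of_forall fun z => ?_)
        simp only
        rw [integral_mul_const, mul_comm, greenPotential, integral_eq_lintegral_of_nonneg_ae]
        · exact Eventually.of_forall fun ξ => mul_nonneg (by positivity) Real.posLog_nonneg
        · exact (hmk.comp (measurable_id.prodMk measurable_const)).aestronglyMeasurable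

/-! ### Disc automorphisms -/

/-- The involutive automorphism of the disc that exchanges `0` and `w`. -/
def mob (w z : ℂ) : ℂ := (w - z) / (1 - (starRingEnd ℂ) w * z)

/-- The derivative of `mob w`. -/
def mobDeriv (w z : ℂ) : ℂ :=
  -((1 - ‖w‖ ^ 2 : ℝ) : ℂ) / (1 - (starRingEnd ℂ) w * z) ^ 2

theorem mob_zero (w : ℂ) : mob w 0 = w := by simp [mob]

theorem measurable_mob : Measurable fun p : ℂ × ℂ => mob p.1 p.2 := by
  unfold mob
  fun_prop

theorem measurable_mob_right (w : ℂ) : Measurable (mob w) := by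
  unfold mob; fun_prop

theorem re_one_sub_conj_mul_pos {w z : ℂ} (hw : ‖w‖ < 1) (hz : ‖z‖ < 1) :
    0 < (1 - (starRingEnd ℂ) w * z).re := by
  have h1 : ‖(starRingEnd ℂ) w * z‖ < 1 := by
    rw [norm_mul, RCLike.norm_conj]
    nlinarith [norm_nonneg w, norm_nonneg z]
  have h2 := Complex.re_le_norm ((starRingEnd ℂ) w * z)
  rw [Complex.sub_re, Complex.one_re]
  linarith

theorem one_sub_conj_mul_ne_zero {w z : ℂ} (hw : ‖w‖ < 1) (hz : ‖z‖ < 1) :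
    1 - (starRingEnd ℂ) w * z ≠ 0 := by
  intro h
  have := re_one_sub_conj_mul_pos hw hz
  rw [h] at this
  simp at this

theorem one_sub_sq_norm_pos {z : ℂ} (hz : ‖z‖ < 1) : 0 < 1 - ‖z‖ ^ 2 := by
  nlinarith [norm_nonneg z]

theorem one_sub_sq_norm_mob {w z : ℂ} (hw : ‖w‖ < 1) (hz : ‖z‖ < 1) :
    1 - ‖mob w z‖ ^ 2
      = (1 - ‖w‖ ^ 2) * (1 - ‖z‖ ^ 2) / ‖1 - (starRingEnd ℂ) w * z‖ ^ 2 := by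
  have h0 : ‖1 - (starRingEnd ℂ) w * z‖ ^ 2 ≠ 0 := by
    simpa using one_sub_conj_mul_ne_zero hw hz
  rw [mob, norm_div, div_pow, eq_div_iff h0, sub_mul, div_mul_cancel₀ _ h0]
  simp only [← Complex.normSq_eq_norm_sq, Complex.normSq_apply, Complex.sub_re, Complex.sub_im,
    Complex.mul_re, Complex.mul_im, Complex.one_re, Complex.one_im, Complex.conj_re,
    Complex.conj_im]
  ring

theorem norm_mob_lt_one {w z : ℂ} (hw : ‖w‖ < 1) (hz : ‖z‖ < 1) : ‖mob w z‖ < 1 := by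
  have h1 : 0 < 1 - ‖mob w z‖ ^ 2 := by
    rw [one_sub_sq_norm_mob hw hz]
    have := one_sub_sq_norm_pos hw
    have := one_sub_sq_norm_pos hz
    have := norm_pos_iff.2 (one_sub_conj_mul_ne_zero hw hz)
    positivity
  nlinarith [norm_nonneg (mob w z)]

theorem mob_mob {w z : ℂ} (hw : ‖w‖ < 1) (hz : ‖z‖ < 1) : mob w (mob w z) = z := by
  have h0 := one_sub_conj_mul_ne_zero hw hz
  have h1 := one_sub_conj_mul_ne_zero hw (norm_mob_lt_one hw hz)
  have h2 : mob w z * (1 - (starRingEnd ℂ) w * z) = w - z := div_mul_cancel₀ _ h0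
  rw [mob, div_eq_iff h1]
  linear_combination -h2

/-- This symmetry makes the kernel `greenPotential t ‖mob w x‖` symmetric in its two points, so that
it can be integrated over either one. -/
theorem norm_mob_comm {w z : ℂ} : ‖mob w z‖ = ‖mob z w‖ := by
  have h : 1 - (starRingEnd ℂ) z * w = (starRingEnd ℂ) (1 - (starRingEnd ℂ) w * z) := by
    simp [mul_comm]
  rw [mob, mob, norm_div, norm_div, h, RCLike.norm_conj, norm_sub_rev]

theorem hasDerivAt_mob {w z : ℂ} (hw : ‖w‖ < 1) (hz : ‖z‖ < 1) :
    HasDerivAt (mob w) (mobDeriv w z) z := by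
  have h0 := one_sub_conj_mul_ne_zero hw hz
  have h1 := ((hasDerivAt_id z).const_sub w).div
    (((hasDerivAt_id z).const_mul ((starRingEnd ℂ) w)).const_sub 1) h0
  refine h1.congr_deriv ?_
  have h2 : ((1 - ‖w‖ ^ 2 : ℝ) : ℂ) = 1 - (starRingEnd ℂ) w * w := by
    rw [← Complex.normSq_eq_norm_sq, ← Complex.normSq_eq_conj_mul_self]
    push_cast; rfl
  rw [mobDeriv, h2]
  simp only [id]
  congr 1
  ring

/-- Existence suffices: the second derivative of `mob w` cancels from the Laplacian of a
composition. -/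
theorem hasDerivAt_mobDeriv {w z : ℂ} (hw : ‖w‖ < 1) (hz : ‖z‖ < 1) :
    ∃ d, HasDerivAt (mobDeriv w) d z := by
  have h0 := one_sub_conj_mul_ne_zero hw hz
  have h1 : DifferentiableAt ℂ (mobDeriv w) z := by
    unfold mobDeriv
    exact (differentiableAt_const _).div (by fun_prop) (pow_ne_zero 2 h0)
  exact ⟨_, h1.hasDerivAt⟩

/-- The equality case of Schwarz–Pick; it expresses invariance of the hyperbolic metric and
underlies every change of variables below. -/
theorem one_sub_sq_norm_mul_mobDeriv {w z : ℂ} (hw : ‖w‖ < 1) (hz : ‖z‖ < 1) :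
    (1 - ‖z‖ ^ 2) * ‖mobDeriv w z‖ = 1 - ‖mob w z‖ ^ 2 := by
  rw [one_sub_sq_norm_mob hw hz, mobDeriv, norm_div, norm_neg, Complex.norm_real, norm_pow,
    Real.norm_of_nonneg (one_sub_sq_norm_pos hw).le]
  ring

theorem contDiffOn_mob {w : ℂ} (hw : ‖w‖ < 1) : ContDiffOn ℝ 2 (mob w) (ball 0 1) := by
  have h : ContDiffOn ℂ 2 (mob w) (ball 0 1) := by
    refine DifferentiableOn.contDiffOn (fun z hz => ?_) isOpen_ball
    exact (hasDerivAt_mob hw (mem_ball_zero_iff.1 hz)).differentiableAt.differentiableWithinAt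
  exact h.restrict_scalars ℝ

theorem mapsTo_mob {w : ℂ} (hw : ‖w‖ < 1) : Set.MapsTo (mob w) (ball 0 1) (ball 0 1) :=
  fun _ hz => mem_ball_zero_iff.2 (norm_mob_lt_one hw (mem_ball_zero_iff.1 hz))

theorem injOn_mob {w : ℂ} (hw : ‖w‖ < 1) : Set.InjOn (mob w) (ball 0 1) := by
  intro x hx y hy h
  rw [← mob_mob hw (mem_ball_zero_iff.1 hx), h, mob_mob hw (mem_ball_zero_iff.1 hy)]

theorem image_mob {w : ℂ} (hw : ‖w‖ < 1) : mob w '' ball 0 1 = ball 0 1 := by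
  refine (mapsTo_mob hw).image_subset.antisymm fun z hz => ?_
  exact ⟨mob w z, mapsTo_mob hw hz, mob_mob hw (mem_ball_zero_iff.1 hz)⟩

theorem det_smul_one_complex (a : ℂ) : (a • (1 : ℂ →L[ℝ] ℂ)).det = ‖a‖ ^ 2 := by
  rw [ContinuousLinearMap.det, ← Complex.normSq_eq_norm_sq, ← Algebra.norm_complex_apply,
    Algebra.norm_apply]
  congr 1

theorem invWeight_mul_mobDeriv {w z : ℂ} (hw : ‖w‖ < 1) (hz : ‖z‖ < 1) :
    ENNReal.ofReal (‖mobDeriv w z‖ ^ 2) * invWeight ‖mob w z‖ = invWeight ‖z‖ := by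
  rw [invWeight, invWeight, ← ENNReal.ofReal_mul (by positivity),
    ← one_sub_sq_norm_mul_mobDeriv hw hz]
  congr 1
  have h2 : ‖mobDeriv w z‖ ≠ 0 := by
    rw [norm_ne_zero_iff, mobDeriv]
    refine div_ne_zero (neg_ne_zero.2 ?_) (pow_ne_zero 2 (one_sub_conj_mul_ne_zero hw hz))
    exact_mod_cast (one_sub_sq_norm_pos hw).ne'
  field_simp

/-- The real Jacobian of `mob w` is `‖mobDeriv w z‖²`, which the equality case of Schwarz–Pick
matches with the change in `(1 - |z|²)⁻²`. -/
theorem measurePreserving_mob {w : ℂ} (hw : ‖w‖ < 1) :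
    MeasurePreserving (mob w) invMeasure invMeasure := by
  refine ⟨measurable_mob_right w, Measure.ext_of_lintegral _ fun f hf => ?_⟩
  have hfm : Measurable fun z => f (mob w z) := hf.comp (measurable_mob_right w)
  rw [lintegral_map hf (measurable_mob_right w), invMeasure,
    lintegral_radialMeasure measurable_invWeight hfm, lintegral_radialMeasure measurable_invWeight hf]
  have h1 := lintegral_image_eq_lintegral_abs_det_fderiv_mul volume (s := ball (0 : ℂ) 1)
    measurableSet_ball (f := mob w) (f' := fun z => mobDeriv w z • (1 : ℂ →L[ℝ] ℂ))
    (fun z hz => (hasDerivAt_mob hw (mem_ball_zero_iff.1 hz)).complexToReal_fderiv.hasFDerivWithinAt)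
    (injOn_mob hw) (fun z => invWeight ‖z‖ * f z)
  rw [image_mob hw] at h1
  rw [h1]
  refine setLIntegral_congr_fun measurableSet_ball fun z hz => ?_
  simp only [det_smul_one_complex]
  rw [abs_of_nonneg (by positivity), ← mul_assoc,
    invWeight_mul_mobDeriv hw (mem_ball_zero_iff.1 hz)]

theorem ae_invMeasure_mem_ball : ∀ᵐ z ∂invMeasure, ‖z‖ < 1 := by
  filter_upwards [ae_radialMeasure_mem_ball invWeight] with z hz using mem_ball_zero_iff.1 hz

theorem integral_comp_mob {w : ℂ} (hw : ‖w‖ < 1) {f : ℂ → ℝ}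
    (hf : AEStronglyMeasurable f invMeasure) :
    ∫ z, f (mob w z) ∂invMeasure = ∫ z, f z ∂invMeasure := by
  have h := measurePreserving_mob hw
  conv_rhs => rw [← h.map_eq]
  rw [integral_map h.measurable.aemeasurable (by rwa [h.map_eq])]

/-! ### The measure `λ_t` and disc automorphisms -/

/-- The density of `λ_t` with respect to the invariant measure, as a function of `1 - |z|²`. -/
def relWeight (t x : ℝ) : ℝ≥0∞ := ENNReal.ofReal ((t + 1) / Real.pi * x ^ (t + 2))

theorem measurable_relWeight (t : ℝ) : Measurable (relWeight t) := by
  unfold relWeight; fun_prop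

theorem weightedMeasure_eq_withDensity (t : ℝ) :
    weightedMeasure t = invMeasure.withDensity fun z => relWeight t (1 - ‖z‖ ^ 2) := by
  have hm := measurable_relWeight t
  have hm' := measurable_invWeight
  rw [invMeasure, radialMeasure, ← withDensity_mul _ (by fun_prop) (by fun_prop), weightedMeasure]
  refine withDensity_congr_ae ?_
  filter_upwards [ae_restrict_mem measurableSet_ball] with z hz
  have h1 := one_sub_sq_norm_pos (mem_ball_zero_iff.1 hz)
  rw [Pi.mul_apply, invWeight, relWeight, ← ENNReal.ofReal_mul (by positivity),
    Real.rpow_add h1, Real.rpow_two]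
  congr 1
  field_simp

theorem lintegral_weightedMeasure (t : ℝ) (f : ℂ → ℝ≥0∞) :
    ∫⁻ z, f z ∂weightedMeasure t = ∫⁻ z, relWeight t (1 - ‖z‖ ^ 2) * f z ∂invMeasure := by
  have hm := measurable_relWeight t
  rw [weightedMeasure_eq_withDensity,
    lintegral_withDensity_eq_lintegral_mul_non_measurable _ (by fun_prop)]
  · rfl
  · exact Eventually.of_forall fun z => ENNReal.ofReal_lt_top

/-- The Radon–Nikodym density of the image of `λ_t` under `mob w`. -/
def mobDensity (t : ℝ) (w z : ℂ) : ℝ :=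
  ((1 - ‖w‖ ^ 2) / ‖1 - (starRingEnd ℂ) w * z‖ ^ 2) ^ (t + 2)

theorem measurable_mobDensity (t : ℝ) (w : ℂ) : Measurable (mobDensity t w) := by
  unfold mobDensity; fun_prop

/-- Relative to the invariant measure, `λ_t` has a density depending on `1 - |z|²` only. As `mob w`
is an involution preserving that measure, the image density is the same function of `1 - |mob w
z|²`, and the quotient of the two is `mobDensity`. -/
theorem map_mob_weightedMeasure (t : ℝ) {w : ℂ} (hw : ‖w‖ < 1) :
    (weightedMeasure t).map (mob w)
      = (weightedMeasure t).withDensity fun z => ENNReal.ofReal (mobDensity t w z) := by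
  have hmm := measurable_mob_right w
  have hm := measurable_relWeight t
  have hm' := measurable_mobDensity t w
  refine Measure.ext_of_lintegral _ fun f hf => ?_
  rw [lintegral_map hf hmm, lintegral_withDensity_eq_lintegral_mul _ (by fun_prop) hf,
    lintegral_weightedMeasure, lintegral_weightedMeasure]
  have h1 := (measurePreserving_mob hw).lintegral_comp
    (f := fun z => relWeight t (1 - ‖mob w z‖ ^ 2) * f z) (by fun_prop)
  have h2 : ∀ᵐ z ∂invMeasure, relWeight t (1 - ‖z‖ ^ 2) * f (mob w z)
      = relWeight t (1 - ‖mob w (mob w z)‖ ^ 2) * f (mob w z) := by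
    filter_upwards [ae_invMeasure_mem_ball] with z hz
    rw [mob_mob hw hz]
  rw [lintegral_congr_ae h2, h1]
  refine lintegral_congr_ae ?_
  filter_upwards [ae_invMeasure_mem_ball] with z hz
  have h3 := one_sub_sq_norm_pos hz
  have h4 := one_sub_sq_norm_pos hw
  simp only [Pi.mul_apply]
  rw [← mul_assoc, relWeight, relWeight, mobDensity, one_sub_sq_norm_mob hw hz, mul_div_right_comm,
    Real.mul_rpow (by positivity) h3.le, ← ENNReal.ofReal_mul' (by positivity)]
  congr 2
  ring

/-! ### Chain rules for the Laplacian -/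

/-- The square of the norm of the gradient. -/
def gradSq (G : ℂ → ℝ) (z : ℂ) : ℝ := fderiv ℝ G z 1 ^ 2 + fderiv ℝ G z Complex.I ^ 2

/-- Reduces a diagonal second derivative to differentiating the directional derivative in one fixed
direction, so chain rules are needed only for scalar functions. -/
theorem fderiv_fderiv_apply {G : ℂ → ℝ} {z v : ℂ} (hG : ContDiffAt ℝ 2 G z) {D : ℂ →L[ℝ] ℝ}
    (hD : HasFDerivAt (fun x => fderiv ℝ G x v) D z) : fderiv ℝ (fderiv ℝ G) z v v = D v := by
  have h1 : DifferentiableAt ℝ (fderiv ℝ G) z :=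
    (hG.fderiv_right (m := 1) (by norm_num)).differentiableAt (by norm_num)
  have h2 := h1.hasFDerivAt.clm_apply (hasFDerivAt_const v z)
  rw [hD.unique h2]
  simp

theorem gradSq_comp_mob {g : ℂ → ℝ} (hg : ContDiffOn ℝ 2 g (ball 0 1)) {w z : ℂ} (hw : ‖w‖ < 1)
    (hz : ‖z‖ < 1) :
    gradSq (fun x => g (mob w x)) z = ‖mobDeriv w z‖ ^ 2 * gradSq g (mob w z) := by
  have hmem : mob w z ∈ ball (0 : ℂ) 1 := mapsTo_mob hw (mem_ball_zero_iff.2 hz)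
  have h1 : HasFDerivAt g (fderiv ℝ g (mob w z)) (mob w z) :=
    ((hg.contDiffAt (isOpen_ball.mem_nhds hmem)).differentiableAt (by norm_num)).hasFDerivAt
  have h2 := h1.comp z (hasDerivAt_mob hw hz).complexToReal_fderiv
  have h3 : fderiv ℝ (fun x => g (mob w x)) z
      = (fderiv ℝ g (mob w z)).comp (mobDeriv w z • (1 : ℂ →L[ℝ] ℂ)) := h2.fderiv
  -- The bilinear form is the rank-one form `(u, v) ↦ L u * L v` with `L` the derivative of `g`; its
  -- trace is the squared gradient.
  have h4 := bilinear_add_bilinear_mul_I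
    ((fderiv ℝ g (mob w z)).smulRight (fderiv ℝ g (mob w z))) (mobDeriv w z)
  simp only [gradSq, h3]
  simp only [ContinuousLinearMap.smulRight_apply, smul_apply, smul_eq_mul] at h4
  simpa [sq] using h4

/-- For holomorphic `φ` the second-order term contributes `Dg (φ'' v²)` in the direction `v`. The
directions `1` and `i` give opposite values, so only the conformal factor remains. -/
theorem laplacian_comp_mob {g : ℂ → ℝ} (hg : ContDiffOn ℝ 2 g (ball 0 1)) {w z : ℂ}
    (hw : ‖w‖ < 1) (hz : ‖z‖ < 1) :
    Δ (fun x => g (mob w x)) z = ‖mobDeriv w z‖ ^ 2 * Δ g (mob w z) := by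
  have hd : ∀ x ∈ ball (0 : ℂ) 1, HasFDerivAt g (fderiv ℝ g (mob w x)) (mob w x) := fun x hx =>
    ((hg.contDiffAt (isOpen_ball.mem_nhds (mapsTo_mob hw hx))).differentiableAt
      (by norm_num)).hasFDerivAt
  have hz' : z ∈ ball (0 : ℂ) 1 := mem_ball_zero_iff.2 hz
  have hd2 : HasFDerivAt (fderiv ℝ g) (fderiv ℝ (fderiv ℝ g) (mob w z)) (mob w z) :=
    (((hg.contDiffAt (isOpen_ball.mem_nhds (mapsTo_mob hw hz'))).fderiv_right (m := 1)
      (by norm_num)).differentiableAt (by norm_num)).hasFDerivAt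
  obtain ⟨d, hdd⟩ := hasDerivAt_mobDeriv hw hz
  have hG : ContDiffAt ℝ 2 (fun x => g (mob w x)) z :=
    (hg.comp (contDiffOn_mob hw) (mapsTo_mob hw)).contDiffAt (isOpen_ball.mem_nhds hz')
  have h1 : ∀ v, fderiv ℝ (fderiv ℝ fun x => g (mob w x)) z v v
      = fderiv ℝ (fderiv ℝ g) (mob w z) (mobDeriv w z * v) (mobDeriv w z * v)
        + fderiv ℝ g (mob w z) (d * v * v) := by
    intro v
    have h2 : (fun x => fderiv ℝ (fun x => g (mob w x)) x v)
        =ᶠ[𝓝 z] fun x => fderiv ℝ g (mob w x) (mobDeriv w x * v) := by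
      filter_upwards [isOpen_ball.mem_nhds hz'] with x hx
      have h3 := (hd x hx).comp x (hasDerivAt_mob hw (mem_ball_zero_iff.1 hx)).complexToReal_fderiv
      have h4 : fderiv ℝ (fun x => g (mob w x)) x
        = (fderiv ℝ g (mob w x)).comp (mobDeriv w x • (1 : ℂ →L[ℝ] ℂ)) := h3.fderiv
      rw [h4]
      simp
    have h5 : HasFDerivAt (fun x => fderiv ℝ g (mob w x)) _ z :=
      hd2.comp z (hasDerivAt_mob hw hz).complexToReal_fderiv
    have h6 := h5.clm_apply (hdd.mul_const v).complexToReal_fderiv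
    rw [fderiv_fderiv_apply hG (h6.congr_of_eventuallyEq h2)]
    simp [add_comm]
  rw [laplacian_eq_fderiv_fderiv, laplacian_eq_fderiv_fderiv, h1, h1,
    ← bilinear_add_bilinear_mul_I]
  have h7 : d * Complex.I * Complex.I = -(d * 1 * 1) := by
    rw [mul_assoc, Complex.I_mul_I]; ring
  rw [h7, map_neg]
  simp only [mul_one]
  ring

theorem laplacian_sub_sq {G : ℂ → ℝ} {z : ℂ} (hG : ContDiffAt ℝ 2 G z) (c : ℝ) :
    Δ (fun x => (G x - c) ^ 2) z = 2 * (gradSq G z + (G z - c) * Δ G z) := by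
  have hd2 : HasFDerivAt (fderiv ℝ G) (fderiv ℝ (fderiv ℝ G) z) z :=
    ((hG.fderiv_right (m := 1) (by norm_num)).differentiableAt (by norm_num)).hasFDerivAt
  have hd := (hG.differentiableAt (by norm_num)).hasFDerivAt
  have hG' : ContDiffAt ℝ 2 (fun x => (G x - c) ^ 2) z := (hG.sub contDiffAt_const).pow 2
  have h1 : ∀ v, fderiv ℝ (fderiv ℝ fun x => (G x - c) ^ 2) z v v
      = 2 * (fderiv ℝ G z v ^ 2 + (G z - c) * fderiv ℝ (fderiv ℝ G) z v v) := by
    intro v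
    have h2 : (fun x => fderiv ℝ (fun x => (G x - c) ^ 2) x v)
        =ᶠ[𝓝 z] fun x => 2 * ((G x - c) * fderiv ℝ G x v) := by
      filter_upwards [hG.eventually (by simp)] with x hx
      have h3 := ((hx.differentiableAt (by norm_num)).hasFDerivAt.sub_const c).pow 2
      rw [h3.fderiv]
      simp
      ring
    have h4 := ((hd.sub_const c).mul (hd2.clm_apply (hasFDerivAt_const v z))).const_mul 2
    rw [fderiv_fderiv_apply hG' (h4.congr_of_eventuallyEq h2)]
    simp
    ring
  rw [laplacian_eq_fderiv_fderiv, laplacian_eq_fderiv_fderiv, h1, h1, gradSq]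
  ring

/-! ### The Bergman kernel -/

/-- The reproducing kernel of the weighted Bergman space, `w ↦ (1 - z̄ w)^{-(t + 2)}`. -/
def bergmanKernel (t : ℝ) (z w : ℂ) : ℂ := (1 - (starRingEnd ℂ) z * w) ^ ((-(t + 2) : ℝ) : ℂ)

theorem norm_bergmanKernel (t : ℝ) (z w : ℂ) :
    ‖bergmanKernel t z w‖ = ‖1 - (starRingEnd ℂ) z * w‖ ^ (-(t + 2)) := by
  rw [bergmanKernel, Complex.norm_cpow_real]

theorem bergmanKernel_ne_zero (t : ℝ) {z w : ℂ} (hz : ‖z‖ < 1) (hw : ‖w‖ < 1) :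
    bergmanKernel t z w ≠ 0 := by
  rw [← norm_ne_zero_iff, norm_bergmanKernel]
  exact (Real.rpow_pos_of_pos (norm_pos_iff.2 (one_sub_conj_mul_ne_zero hz hw)) _).ne'

theorem bergmanKernel_self_mul (t : ℝ) {z : ℂ} (hz : ‖z‖ < 1) :
    bergmanKernel t z z * (((1 - ‖z‖ ^ 2) ^ (t + 2) : ℝ) : ℂ) = 1 := by
  have h1 := one_sub_sq_norm_pos hz
  have h2 : 1 - (starRingEnd ℂ) z * z = ((1 - ‖z‖ ^ 2 : ℝ) : ℂ) := by
    rw [← Complex.normSq_eq_norm_sq, ← Complex.normSq_eq_conj_mul_self]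
    push_cast; rfl
  rw [bergmanKernel, h2, ← Complex.ofReal_cpow h1.le, ← Complex.ofReal_mul,
    ← Real.rpow_add h1, neg_add_cancel, Real.rpow_zero, Complex.ofReal_one]

/-- In other words, the density is `|K_z(w)|² / K_z(z)`, with `K_z` the kernel at `z`. This is the
link between disc automorphisms and the Bergman kernel. -/
theorem mobDensity_eq (t : ℝ) {z w : ℂ} (hz : ‖z‖ < 1) :
    mobDensity t z w = (1 - ‖z‖ ^ 2) ^ (t + 2) * ‖bergmanKernel t z w‖ ^ 2 := by
  have h1 := (one_sub_sq_norm_pos hz).le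
  have h2 : ∀ x : ℝ, 0 ≤ x → (x ^ 2) ^ (t + 2) = (x ^ (t + 2)) ^ 2 := by
    intro x hx
    rw [← Real.rpow_natCast, ← Real.rpow_natCast (x ^ (t + 2)), ← Real.rpow_mul hx,
      ← Real.rpow_mul hx, mul_comm]
  rw [mobDensity, norm_bergmanKernel, Real.div_rpow h1 (by positivity), Real.rpow_neg (by positivity),
    inv_pow, h2 _ (norm_nonneg _), div_eq_mul_inv]

theorem mobDensity_nonneg (t : ℝ) {z w : ℂ} (hz : ‖z‖ < 1) : 0 ≤ mobDensity t z w := by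
  rw [mobDensity_eq t hz]
  have := one_sub_sq_norm_pos hz
  positivity

theorem differentiableOn_bergmanKernel (t : ℝ) {z : ℂ} (hz : ‖z‖ < 1) :
    DifferentiableOn ℂ (bergmanKernel t z) (ball 0 1) := by
  intro w hw
  have h1 : 1 - (starRingEnd ℂ) z * w ∈ Complex.slitPlane :=
    Or.inl (re_one_sub_conj_mul_pos hz (mem_ball_zero_iff.1 hw))
  unfold bergmanKernel
  exact (DifferentiableAt.cpow (f := fun w => 1 - (starRingEnd ℂ) z * w) (by fun_prop)
    (differentiableAt_const _) h1).differentiableWithinAt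

theorem norm_bergmanKernel_le {t : ℝ} (ht : -1 < t) {z w : ℂ} (hz : ‖z‖ < 1) (hw : ‖w‖ < 1) :
    ‖bergmanKernel t z w‖ ≤ (1 - ‖z‖) ^ (-(t + 2)) := by
  rw [norm_bergmanKernel]
  refine Real.rpow_le_rpow_of_nonpos (by linarith) ?_ (by linarith)
  have h1 := norm_sub_norm_le (1 : ℂ) ((starRingEnd ℂ) z * w)
  rw [norm_one, norm_mul, RCLike.norm_conj] at h1
  nlinarith [norm_nonneg z, norm_nonneg w]

theorem ae_weightedMeasure_mem_ball (t : ℝ) : ∀ᵐ z ∂weightedMeasure t, ‖z‖ < 1 := by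
  filter_upwards [ae_radialMeasure_mem_ball (weight t)] with z hz using mem_ball_zero_iff.1 hz

theorem aestronglyMeasurable_weightedMeasure (t : ℝ) {E : Type*} [NormedAddCommGroup E]
    {F : ℂ → E} (hF : ContinuousOn F (ball 0 1)) :
    AEStronglyMeasurable F (weightedMeasure t) :=
  (hF.aestronglyMeasurable measurableSet_ball).mono_ac
    (radialMeasure_absolutelyContinuous (weight t))

theorem memLp_bergmanKernel {t : ℝ} (ht : -1 < t) {z : ℂ} (hz : ‖z‖ < 1) (p : ℝ≥0∞) :
    MemLp (bergmanKernel t z) p (weightedMeasure t) := by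
  have := isProbabilityMeasure_weightedMeasure ht
  refine MemLp.of_bound (aestronglyMeasurable_weightedMeasure t
    (differentiableOn_bergmanKernel t hz).continuousOn) ((1 - ‖z‖) ^ (-(t + 2))) ?_
  filter_upwards [ae_weightedMeasure_mem_ball t] with w hw using norm_bergmanKernel_le ht hz hw

/-- Every circle average of `F` about `0` equals `F 0`, and `λ_t` is a radial probability measure.
-/
theorem integral_weightedMeasure_of_differentiableOn {t : ℝ} (ht : -1 < t) {F : ℂ → ℂ}
    (hF : DifferentiableOn ℂ F (ball 0 1)) (hi : Integrable F (weightedMeasure t)) :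
    ∫ z, F z ∂weightedMeasure t = F 0 := by
  have := isProbabilityMeasure_weightedMeasure ht
  have h1 := (integral_radialMeasure_eq_circleAverage (measurable_weight t) hF.continuousOn hi).2
  rw [← weightedMeasure_eq_radialMeasure] at h1
  rw [h1]
  have h2 : ∀ᵐ z ∂weightedMeasure t, Real.circleAverage F 0 ‖z‖ = F 0 := by
    filter_upwards [ae_weightedMeasure_mem_ball t] with z hz
    refine DiffContOnCl.circleAverage ?_
    rw [abs_norm]
    refine (hF.mono ?_).diffContOnCl
    exact closure_ball_subset_closedBall.trans (closedBall_subset_ball hz)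
  rw [integral_congr_ae h2]
  simp

/-- Apply the mean value property to `(F / K_z) ∘ mob z`, whose value at `0` is `F z / K_z(z)`.
Changing variables brings in the density `|K_z|² / K_z(z)`, and `|K_z|² F / K_z` is `F` times the
conjugate of `K_z`. -/
theorem integral_conj_bergmanKernel_mul {t : ℝ} (ht : -1 < t) {F : ℂ → ℂ}
    (hF : DifferentiableOn ℂ F (ball 0 1)) (hF2 : MemLp F 2 (weightedMeasure t)) {z : ℂ}
    (hz : ‖z‖ < 1) :
    ∫ w, F w * (starRingEnd ℂ) (bergmanKernel t z w) ∂weightedMeasure t = F z := by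
  have := isProbabilityMeasure_weightedMeasure ht
  set c : ℝ := (1 - ‖z‖ ^ 2) ^ (t + 2) with hc
  let H : ℂ → ℂ := fun w => F w / bergmanKernel t z w
  have hH : DifferentiableOn ℂ H (ball 0 1) :=
    hF.div (differentiableOn_bergmanKernel t hz)
      fun w hw => bergmanKernel_ne_zero t hz (mem_ball_zero_iff.1 hw)
  have hmob : DifferentiableOn ℂ (mob z) (ball 0 1) := fun w hw =>
    (hasDerivAt_mob hz (mem_ball_zero_iff.1 hw)).differentiableAt.differentiableWithinAt
  have hHm : DifferentiableOn ℂ (fun w => H (mob z w)) (ball 0 1) :=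
    hH.comp hmob (mapsTo_mob hz)
  have hdens : ∀ᵐ w ∂weightedMeasure t, (ENNReal.ofReal (mobDensity t z w)).toReal • H w
      = c * (F w * (starRingEnd ℂ) (bergmanKernel t z w)) := by
    filter_upwards [ae_weightedMeasure_mem_ball t] with w hw
    rw [ENNReal.toReal_ofReal (mobDensity_nonneg t hz), mobDensity_eq t hz, ← hc, Complex.real_smul,
      ← Complex.normSq_eq_norm_sq, Complex.ofReal_mul, ← Complex.mul_conj]
    have := bergmanKernel_ne_zero t hz hw
    simp only [H]
    field_simp
  have hmeas := measurable_mobDensity t z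
  have hac : (weightedMeasure t).map (mob z) ≪ weightedMeasure t := by
    rw [map_mob_weightedMeasure t hz]
    exact withDensity_absolutelyContinuous _ _
  have hHmeas : AEStronglyMeasurable H ((weightedMeasure t).map (mob z)) :=
    (aestronglyMeasurable_weightedMeasure t hH.continuousOn).mono_ac hac
  have hi : Integrable (fun w => H (mob z w)) (weightedMeasure t) := by
    refine (integrable_map_measure hHmeas (measurable_mob_right z).aemeasurable).1 ?_
    rw [map_mob_weightedMeasure t hz, integrable_withDensity_iff_integrable_smul' (by fun_prop)
      (Eventually.of_forall fun _ => ENNReal.ofReal_lt_top), integrable_congr hdens]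
    refine Integrable.const_mul ?_ _
    refine (hF2.integrable (by norm_num)).mul_bdd (c := (1 - ‖z‖) ^ (-(t + 2))) ?_ ?_
    · exact Complex.continuous_conj.comp_aestronglyMeasurable
        (aestronglyMeasurable_weightedMeasure t (differentiableOn_bergmanKernel t hz).continuousOn)
    · filter_upwards [ae_weightedMeasure_mem_ball t] with w hw
      rw [RCLike.norm_conj]
      exact norm_bergmanKernel_le ht hz hw
  have h1 := integral_weightedMeasure_of_differentiableOn ht hHm hi
  rw [← integral_map (measurable_mob_right z).aemeasurable hHmeas, map_mob_weightedMeasure t hz,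
    integral_withDensity_eq_integral_toReal_smul (by fun_prop)
      (Eventually.of_forall fun _ => ENNReal.ofReal_lt_top), integral_congr_ae hdens,
    integral_const_mul, mob_zero] at h1
  have h2 := bergmanKernel_self_mul t hz
  rw [← hc] at h2
  have h3 : F z = bergmanKernel t z z * H z :=
    (mul_div_cancel₀ _ (bergmanKernel_ne_zero t hz hz)).symm
  rw [h3, ← h1, ← mul_assoc, h2, one_mul]

open Classical in
/-- The Bergman kernel function at `z` as an element of `L²(𝔻, λ_t)`; zero when it is not square
integrable. -/
def kernelVec (t : ℝ) (z : ℂ) : WeightedL2 t :=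
  if h : MemLp (bergmanKernel t z) 2 (weightedMeasure t) then h.toLp else 0

theorem kernelVec_coeFn {t : ℝ} (ht : -1 < t) {z : ℂ} (hz : ‖z‖ < 1) :
    kernelVec t z =ᵐ[weightedMeasure t] bergmanKernel t z := by
  rw [kernelVec, dif_pos (memLp_bergmanKernel ht hz 2)]
  exact MemLp.coeFn_toLp _

theorem kernelVec_mem_bergmanSpace {t : ℝ} (ht : -1 < t) {z : ℂ} (hz : ‖z‖ < 1) :
    kernelVec t z ∈ bergmanSpace t :=
  ⟨_, differentiableOn_bergmanKernel t hz, kernelVec_coeFn ht hz⟩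

/-- The projection is self-adjoint and fixes the kernel vector, so `f` may be replaced by its
projection, to which the reproducing property applies. -/
theorem bergmanProjection_ae_eq_inner {t : ℝ} (ht : -1 < t) (f : WeightedL2 t) :
    bergmanProjection t f =ᵐ[weightedMeasure t] fun z => inner ℂ (kernelVec t z) f := by
  obtain ⟨F, hF, hPF⟩ := (bergmanSpace t).starProjection_apply_mem f
  have hF2 : MemLp F 2 (weightedMeasure t) := (memLp_congr_ae hPF).1 (Lp.memLp _)
  filter_upwards [ae_weightedMeasure_mem_ball t, hPF] with z hz hPz
  have h1 : inner ℂ (kernelVec t z) f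
      = inner ℂ (kernelVec t z) ((bergmanSpace t).starProjection f) := by
    rw [← Submodule.inner_starProjection_left_eq_right,
      Submodule.starProjection_eq_self_iff.2 (kernelVec_mem_bergmanSpace ht hz)]
  rw [h1, bergmanProjection, hPz, L2.inner_def, ← integral_conj_bergmanKernel_mul ht hF hF2 hz]
  refine integral_congr_ae ?_
  filter_upwards [hPF, kernelVec_coeFn ht hz] with w h2 h3
  rw [h2, h3]
  rfl

/-! ### The Hilbert–Schmidt norm of a Hankel operator -/

section Commutator

variable {E : Type*} [NormedAddCommGroup E] [InnerProductSpace ℂ E] [CompleteSpace E]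

theorem hsNormSq_adjoint (T : E →L[ℂ] E) : hsNormSq (ContinuousLinearMap.adjoint T) = hsNormSq T := by
  obtain ⟨_, b, _⟩ := exists_hilbertBasis ℂ E
  rw [hsNormSq_eq_tsum b, hsNormSq_eq_tsum b, ← tsum_enorm_sq_eq_adjoint b b]

/-- The commutator is `H - H*` with `H = (I - P) M P` and `H* = P M (I - P)`, by symmetry of `M`.
Their ranges are orthogonal, so squared norms add on each basis vector, and `H`, `H*` have the same
Hilbert–Schmidt norm. -/
theorem hsNormSq_commutator_starProjection (K : Submodule ℂ E) [K.HasOrthogonalProjection]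
    (M : E →L[ℂ] E) (hM : ∀ x y, inner ℂ (M x) y = inner ℂ x (M y)) :
    hsNormSq (M ∘L K.starProjection - K.starProjection ∘L M)
      = 2 * hsNormSq ((ContinuousLinearMap.id ℂ E - K.starProjection) ∘L M ∘L K.starProjection) := by
  set P := K.starProjection with hP
  have hPsa : ∀ x y, inner ℂ (P x) y = inner ℂ x (P y) :=
    fun x y => K.inner_starProjection_left_eq_right x y
  have hPP : ∀ x, P (P x) = P x := fun x =>
    Submodule.starProjection_eq_self_iff.2 (K.starProjection_apply_mem x)
  set H := (ContinuousLinearMap.id ℂ E - P) ∘L M ∘L P with hH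
  set T := P ∘L M ∘L (ContinuousLinearMap.id ℂ E - P) with hT
  have hadj : ContinuousLinearMap.adjoint H = T := by
    refine ((ContinuousLinearMap.eq_adjoint_iff T H).2 fun x y => ?_).symm
    simp only [hH, hT, ContinuousLinearMap.comp_apply, sub_apply, ContinuousLinearMap.id_apply,
      hPsa, hM, inner_sub_left, inner_sub_right]
  have hsum : ∀ x, ‖(M ∘L P - P ∘L M) x‖ₑ ^ 2 = ‖H x‖ₑ ^ 2 + ‖T x‖ₑ ^ 2 := by
    intro x
    have h1 : (M ∘L P - P ∘L M) x = H x - T x := by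
      simp [hH, hT]
    have h2 : inner ℂ (H x) (T x) = 0 := by
      simp only [hH, hT, ContinuousLinearMap.comp_apply, sub_apply, ContinuousLinearMap.id_apply,
        inner_sub_left, hPsa, hPP, sub_self]
    have h3 : ‖H x - T x‖ ^ 2 = ‖H x‖ ^ 2 + ‖T x‖ ^ 2 := by
      rw [norm_sub_sq (𝕜 := ℂ), h2]; simp
    rw [h1, ← ofReal_norm, ← ofReal_norm, ← ofReal_norm, ← ENNReal.ofReal_pow (norm_nonneg _), h3,
      ENNReal.ofReal_add (by positivity) (by positivity), ENNReal.ofReal_pow (norm_nonneg _),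
      ENNReal.ofReal_pow (norm_nonneg _)]
  obtain ⟨_, b, _⟩ := exists_hilbertBasis ℂ E
  rw [hsNormSq_eq_tsum b]
  simp only [hsum]
  rw [ENNReal.tsum_add, ← hsNormSq_eq_tsum b, ← hsNormSq_eq_tsum b, ← hadj, hsNormSq_adjoint,
    two_mul]

end Commutator

/-- Distinct vectors lie at distance `√2`, so balls of radius `1/2` about them are disjoint.
Countability is what permits exchanging the basis sum with an integral. -/
theorem countable_of_orthonormal {E ι : Type*} [NormedAddCommGroup E]
    [InnerProductSpace ℂ E] [TopologicalSpace.SeparableSpace E] {b : ι → E}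
    (hb : Orthonormal ℂ b) : Countable ι := by
  refine Pairwise.countable_of_isOpen_disjoint (s := fun i => ball (b i) 2⁻¹) ?_
    (fun _ => isOpen_ball) fun i => ⟨b i, mem_ball_self (by norm_num)⟩
  intro i j hij
  refine ball_disjoint_ball ?_
  have h1 : ‖b i - b j‖ ^ 2 = 2 := by
    rw [norm_sub_sq (𝕜 := ℂ), hb.2 hij, hb.1, hb.1]; norm_num
  rw [dist_eq_norm]
  nlinarith [norm_nonneg (b i - b j)]

theorem inner_mulOp_left (t : ℝ) (g : ℂ → ℝ)
    (hg : MemLp (fun z => (g z : ℂ)) ∞ (weightedMeasure t)) (x y : WeightedL2 t) :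
    inner ℂ (mulOp t _ hg x) y = inner ℂ x (mulOp t _ hg y) := by
  rw [L2.inner_def, L2.inner_def]
  refine integral_congr_ae ?_
  filter_upwards [mulOp_coeFn t _ hg x, mulOp_coeFn t _ hg y] with z h1 h2
  rw [h1, h2]
  simp only [RCLike.inner_apply, map_mul, Complex.conj_ofReal]
  ring

theorem enorm_sq_eq_lintegral {μ : Measure ℂ} (f : Lp ℂ 2 μ) :
    ‖f‖ₑ ^ 2 = ∫⁻ z, ‖f z‖ₑ ^ 2 ∂μ := by
  have h := eLpNorm_nnreal_pow_eq_lintegral (f := f) (μ := μ) (p := 2) (by norm_num)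
  rw [Lp.enorm_def]
  simpa using h

-- Lets instance search find that `L²` is separable.
instance : Fact ((2 : ℝ≥0∞) ≠ ∞) := ⟨by norm_num⟩

/-- Parseval is applied to `k z` for each fixed `z`, after the sum over a basis has been exchanged
with the integral over `z`. -/
theorem hsNormSq_eq_lintegral (t : ℝ) (C : WeightedL2 t →L[ℂ] WeightedL2 t)
    (k : ℂ → WeightedL2 t)
    (hk : ∀ f, C f =ᵐ[weightedMeasure t] fun z => inner ℂ (k z) f) :
    hsNormSq C = ∫⁻ z, ‖k z‖ₑ ^ 2 ∂weightedMeasure t := by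
  obtain ⟨ι, b, _⟩ := exists_hilbertBasis ℂ (WeightedL2 t)
  have : Countable ι := countable_of_orthonormal b.orthonormal
  have h1 : ∀ i, ‖C (b i)‖ₑ ^ 2 = ∫⁻ z, ‖inner ℂ (b i) (k z)‖ₑ ^ 2 ∂weightedMeasure t := by
    intro i
    rw [enorm_sq_eq_lintegral]
    refine lintegral_congr_ae ?_
    filter_upwards [hk (b i)] with z hz
    rw [hz, ← inner_conj_symm, RCLike.enorm_conj]
  rw [hsNormSq_eq_tsum b]
  simp only [h1]
  rw [← lintegral_tsum]
  · simp only [← enorm_sq_eq_tsum]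
  · intro i
    -- No measurability of `k` is assumed: that of its coefficients is inherited from the functions
    -- `C (b i)`.
    have h2 : AEMeasurable (fun z => ‖C (b i) z‖ₑ ^ 2) (weightedMeasure t) :=
      (Lp.aestronglyMeasurable _).enorm.pow_const 2
    refine h2.congr ?_
    filter_upwards [hk (b i)] with z hz
    rw [hz, ← inner_conj_symm, RCLike.enorm_conj]

/-- The commutator is represented by the vectors `k z = (g z - M) K_z`. Their squared norms are
turned into `mob`-integrals by the formula for `mobDensity`, and the resulting factor `(1 -
|z|²)^{-(t+2)}` cancels the density of `λ_t` relative to the invariant measure. -/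
theorem two_mul_hsNormSq_hankel {t : ℝ} (ht : -1 < t) {g : ℂ → ℝ}
    (hgc : ContinuousOn g (ball 0 1))
    (hg : MemLp (fun z => (g z : ℂ)) ∞ (weightedMeasure t)) :
    2 * hsNormSq (hankel t _ hg) = ENNReal.ofReal ((t + 1) / Real.pi) *
      ∫⁻ z, ∫⁻ ξ, ENNReal.ofReal ((g (mob z ξ) - g z) ^ 2) ∂weightedMeasure t ∂invMeasure := by
  set M := mulOp t _ hg with hM
  let k : ℂ → WeightedL2 t := fun z => (g z : ℂ) • kernelVec t z - M (kernelVec t z)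
  have hk : ∀ f, (M ∘L bergmanProjection t - bergmanProjection t ∘L M) f
      =ᵐ[weightedMeasure t] fun z => inner ℂ (k z) f := by
    intro f
    rw [sub_apply, ContinuousLinearMap.comp_apply, ContinuousLinearMap.comp_apply]
    filter_upwards [Lp.coeFn_sub (M (bergmanProjection t f)) (bergmanProjection t (M f)),
      mulOp_coeFn t _ hg (bergmanProjection t f), bergmanProjection_ae_eq_inner ht f,
      bergmanProjection_ae_eq_inner ht (M f)] with z h1 h2 h3 h4
    rw [h1, Pi.sub_apply, hM, h2, h3, ← hM, h4]
    simp only [k]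
    rw [inner_sub_left, inner_smul_left, Complex.conj_ofReal, hM, inner_mulOp_left]
  have hkn : ∀ᵐ z ∂weightedMeasure t, ‖k z‖ₑ ^ 2 = ENNReal.ofReal (((1 - ‖z‖ ^ 2) ^ (t + 2))⁻¹) *
      ∫⁻ ξ, ENNReal.ofReal ((g (mob z ξ) - g z) ^ 2) ∂weightedMeasure t := by
    filter_upwards [ae_weightedMeasure_mem_ball t] with z hz
    have hz1 := one_sub_sq_norm_pos hz
    have hmeas : AEMeasurable (fun w => ENNReal.ofReal ((g w - g z) ^ 2)) (weightedMeasure t) :=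
      (((aestronglyMeasurable_weightedMeasure t hgc).aemeasurable.sub_const _).pow_const
        2).ennreal_ofReal
    have hac : (weightedMeasure t).map (mob z) ≪ weightedMeasure t := by
      rw [map_mob_weightedMeasure t hz]
      exact withDensity_absolutelyContinuous _ _
    have hmd := measurable_mobDensity t z
    rw [← lintegral_map' (f := fun w => ENNReal.ofReal ((g w - g z) ^ 2)) (hmeas.mono_ac hac)
      (measurable_mob_right z).aemeasurable, map_mob_weightedMeasure t hz,
      lintegral_withDensity_eq_lintegral_mul₀ (by fun_prop) hmeas,
      ← lintegral_const_mul' _ _ ENNReal.ofReal_ne_top, enorm_sq_eq_lintegral]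
    refine lintegral_congr_ae ?_
    filter_upwards [Lp.coeFn_sub ((g z : ℂ) • kernelVec t z) (M (kernelVec t z)),
      Lp.coeFn_smul (g z : ℂ) (kernelVec t z), mulOp_coeFn t _ hg (kernelVec t z),
      kernelVec_coeFn ht hz] with w h1 h2 h3 h4
    rw [h1, Pi.sub_apply, h2, Pi.smul_apply, hM, h3, h4, Pi.mul_apply, smul_eq_mul, ← sub_mul,
      ← ofReal_norm, ← ENNReal.ofReal_pow (norm_nonneg _),
      ← ENNReal.ofReal_mul (mobDensity_nonneg t hz), ← ENNReal.ofReal_mul (by positivity),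
      mobDensity_eq t hz, norm_mul, ← Complex.ofReal_sub, Complex.norm_real, mul_pow,
      Real.norm_eq_abs, sq_abs]
    congr 1
    field_simp
    ring
  have h2 := hsNormSq_commutator_starProjection (bergmanSpace t) M (inner_mulOp_left t g hg)
  rw [hankel, bergmanProjection, ← h2, ← bergmanProjection, hsNormSq_eq_lintegral t _ k hk,
    lintegral_congr_ae hkn, lintegral_weightedMeasure,
    ← lintegral_const_mul' _ _ ENNReal.ofReal_ne_top]
  refine lintegral_congr_ae ?_
  filter_upwards [ae_invMeasure_mem_ball] with z hz
  have hz1 := one_sub_sq_norm_pos hz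
  rw [← mul_assoc, relWeight, ← ENNReal.ofReal_mul' (by positivity)]
  congr 2
  field_simp

/-! ### Positivity of the mean value defect -/

theorem integrableOn_log_div_norm {r : ℝ} (hr0 : 0 < r) (hr : r < 1) :
    IntegrableOn (fun z : ℂ => Real.log (r / ‖z‖)) (ball 0 r) := by
  have hm : Measurable fun z : ℂ => (2 * Real.pi)⁻¹ * Real.posLog (r / ‖z‖) := by
    fun_prop
  -- Integrability is borrowed from the invariant measure, which dominates Lebesgue measure on the
  -- disc.
  have h1 : Integrable (fun z : ℂ => (2 * Real.pi)⁻¹ * Real.posLog (r / ‖z‖)) invMeasure := by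
    refine ⟨hm.aestronglyMeasurable, ?_⟩
    rw [hasFiniteIntegral_iff_ofReal (Eventually.of_forall fun z =>
      mul_nonneg (by positivity) Real.posLog_nonneg), lintegral_posLog_invMeasure hr0 hr]
    exact ENNReal.ofReal_lt_top
  have h2 := ((h1.mono_measure volume_restrict_le_invMeasure).const_mul (2 * Real.pi)).mono_measure
    (Measure.restrict_mono (ball_subset_ball hr.le) le_rfl)
  refine h2.congr ?_
  filter_upwards [ae_restrict_mem measurableSet_ball, ae_restrict_of_ae (Measure.ae_ne volume 0)]
    with z hz hz0
  have h3 : 1 ≤ r / ‖z‖ := by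
    rw [le_div_iff₀ (norm_pos_iff.2 hz0), one_mul]; exact (mem_ball_zero_iff.1 hz).le
  rw [Real.posLog_eq_log (h3.trans (le_abs_self _)), ← mul_assoc,
    mul_inv_cancel₀ (by positivity), one_mul]

theorem le_circleAverage_of_laplacian_nonneg {G : ℂ → ℝ} {r R : ℝ} (hr : 0 < r) (hrR : r < R)
    (hG : ContDiffOn ℝ 2 G (ball 0 R)) (h0 : ∀ z ∈ ball (0 : ℂ) r, 0 ≤ Δ G z) :
    G 0 ≤ Real.circleAverage G 0 r := by
  rw [← sub_nonneg, circleAverage_sub_eq_integral_laplacian hr hrR hG]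
  refine mul_nonneg (by positivity) (setIntegral_nonneg measurableSet_ball fun z hz => ?_)
  refine mul_nonneg ?_ (h0 z hz)
  rcases eq_or_ne z 0 with rfl | hz0
  · simp
  · refine Real.log_nonneg ?_
    rw [le_div_iff₀ (norm_pos_iff.2 hz0), one_mul]; exact (mem_ball_zero_iff.1 hz).le

/-- Equality in Jensen's formula would make `log (r / |z|) Δ G` vanish almost everywhere, but near
`0` it is positive off the origin. -/
theorem lt_circleAverage_of_laplacian_pos {G : ℂ → ℝ} {r R : ℝ} (hr : 0 < r) (hr1 : r < 1)
    (hrR : r < R) (hG : ContDiffOn ℝ 2 G (ball 0 R)) (h0 : ∀ z ∈ ball (0 : ℂ) r, 0 ≤ Δ G z)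
    (hpos : 0 < Δ G 0) : G 0 < Real.circleAverage G 0 r := by
  have hΔ := continuousOn_laplacian hG
  have hlog : ∀ z ∈ ball (0 : ℂ) r, z ≠ 0 → 0 < Real.log (r / ‖z‖) := by
    intro z hz hz0
    refine Real.log_pos ?_
    rw [lt_div_iff₀ (norm_pos_iff.2 hz0), one_mul]; exact mem_ball_zero_iff.1 hz
  refine (le_circleAverage_of_laplacian_nonneg hr hrR hG h0).lt_of_ne fun h => ?_
  have h1 := circleAverage_sub_eq_integral_laplacian hr hrR hG
  rw [← h, sub_self, eq_comm, mul_eq_zero, or_iff_right (by positivity)] at h1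
  have hint : IntegrableOn (fun z => Real.log (r / ‖z‖) * Δ G z) (ball 0 r) := by
    obtain ⟨L, hL⟩ := (isCompact_closedBall (0 : ℂ) r).exists_bound_of_continuousOn
      (hΔ.mono (closedBall_subset_ball hrR))
    refine (integrableOn_log_div_norm hr hr1).mul_bdd (c := L) ?_ ?_
    · exact (hΔ.mono (ball_subset_ball hrR.le)).aestronglyMeasurable measurableSet_ball
    · filter_upwards [ae_restrict_mem measurableSet_ball] with z hz
      exact hL z (ball_subset_closedBall hz)
  have hnn : 0 ≤ᵐ[volume.restrict (ball (0 : ℂ) r)] fun z => Real.log (r / ‖z‖) * Δ G z := by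
    filter_upwards [ae_restrict_mem measurableSet_ball,
      ae_restrict_of_ae (Measure.ae_ne volume 0)] with z hz hz0
    exact mul_nonneg (hlog z hz hz0).le (h0 z hz)
  rw [integral_eq_zero_iff_of_nonneg_ae hnn hint] at h1
  have hmem0 : (0 : ℂ) ∈ ball (0 : ℂ) R := mem_ball_self (hr.trans hrR)
  obtain ⟨ε, hε, hεr⟩ : ∃ ε > 0, ∀ z ∈ ball (0 : ℂ) ε, z ∈ ball (0 : ℂ) r ∧ 0 < Δ G z := by
    refine Metric.eventually_nhds_iff_ball.1 ?_
    have h2 := (hΔ.continuousAt (isOpen_ball.mem_nhds hmem0)).eventually (lt_mem_nhds hpos)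
    exact Filter.Eventually.and (ball_mem_nhds (0 : ℂ) hr) h2
  have h3 : ∀ᵐ z ∂(volume.restrict (ball (0 : ℂ) ε)), False := by
    filter_upwards [ae_restrict_mem measurableSet_ball,
      ae_restrict_of_ae (Measure.ae_ne volume 0),
      ae_mono (Measure.restrict_mono (fun z hz => (hεr z hz).1) le_rfl) h1] with z hz hz0 hz1
    exact (mul_pos (hlog z (hεr z hz).1 hz0) (hεr z hz).2).ne' hz1
  rw [ae_iff] at h3
  simp only [not_false_eq_true, Set.ofPred_true, Measure.restrict_apply_univ] at h3
  exact (measure_ball_pos volume (0 : ℂ) hε).ne' h3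

/-- If `Δ g` were negative at `c`, it would be so on a small disc, and the strict mean inequality
for `-g`, translated to the origin, would contradict the sub-mean value property. -/
theorem laplacian_nonneg_of_isSubharmonicOn {g : ℂ → ℝ} (hg : ContDiffOn ℝ 2 g (ball 0 1))
    (hsub : IsSubharmonicOn g (ball 0 1)) {c : ℂ} (hc : c ∈ ball (0 : ℂ) 1) : 0 ≤ Δ g c := by
  by_contra! hneg
  have h1 := ((continuousOn_laplacian hg).continuousAt (isOpen_ball.mem_nhds hc)).eventually
    (gt_mem_nhds hneg)
  obtain ⟨ε, hε, hεr⟩ := Metric.eventually_nhds_iff_ball.1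
    (h1.and (isOpen_ball.mem_nhds hc))
  -- `R < ε` keeps the circle where the Laplacian is negative; `R < 1` is required by the strict
  -- mean inequality.
  obtain ⟨R, hR0, hRε, hR1⟩ : ∃ R, 0 < R ∧ R < ε ∧ R < 1 :=
    ⟨min (ε / 2) (1 / 2), by positivity, by
      exact (min_le_left _ _).trans_lt (by linarith), by
      exact (min_le_right _ _).trans_lt (by norm_num)⟩
  have hmem : ∀ z ∈ ball (0 : ℂ) ε, z + c ∈ ball c ε := by
    intro z hz
    simpa [dist_eq_norm] using hz
  have hu : ContDiffOn ℝ 2 (fun z => -g (z + c)) (ball 0 ε) :=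
    (hg.comp (by fun_prop) fun z hz => (hεr _ (hmem z hz)).2).neg
  have hfd : fderiv ℝ (fun z => -g (z + c)) = fun z => -fderiv ℝ g (z + c) := by
    ext1 z
    rw [fderiv_fun_neg, fderiv_comp_add_right]
  have hΔ : ∀ z, Δ (fun z => -g (z + c)) z = -Δ g (z + c) := by
    intro z
    rw [laplacian_eq_fderiv_fderiv, laplacian_eq_fderiv_fderiv, hfd, fderiv_fun_neg,
      fderiv_comp_add_right (f := fderiv ℝ g)]
    simp
    ring
  have h2 := lt_circleAverage_of_laplacian_pos hR0 hR1 hRε hu ?_ ?_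
  · have h3 := hsub.2 c R hR0 (fun z hz => (hεr z (closedBall_subset_ball hRε hz)).2)
    have h4 : Real.circleAverage (fun z => -g (z + c)) 0 R = -Real.circleAverage g c R := by
      rw [← Real.circleAverage_map_add_const (f := g)]
      simp only [Real.circleAverage, intervalIntegral.integral_neg, smul_neg]
    rw [h4] at h2
    simp only [zero_add] at h2
    linarith [h3.2]
  · intro z hz
    rw [hΔ]
    have := (hεr _ (hmem z (ball_subset_ball hRε.le hz))).1
    linarith
  · rw [hΔ, zero_add]
    linarith

/-- The invariant measure with density the Green potential of `λ_t`. -/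
def potentialMeasure (t : ℝ) : Measure ℂ :=
  invMeasure.withDensity fun z => greenPotential t ‖z‖

theorem potentialMeasure_eq_radialMeasure (t : ℝ) :
    potentialMeasure t = radialMeasure fun ρ => invWeight ρ * greenPotential t ρ := by
  have := measurable_greenPotential t
  have := measurable_invWeight
  rw [potentialMeasure, invMeasure, radialMeasure, ← withDensity_mul _ (by fun_prop) (by fun_prop)]
  rfl

theorem potentialMeasure_univ {t : ℝ} (ht : -1 < t) :
    potentialMeasure t Set.univ = ENNReal.ofReal (1 / (4 * (t + 1))) := by
  rw [potentialMeasure, withDensity_apply _ MeasurableSet.univ, setLIntegral_univ,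
    lintegral_greenPotential_invMeasure ht]

theorem isFiniteMeasure_potentialMeasure {t : ℝ} (ht : -1 < t) :
    IsFiniteMeasure (potentialMeasure t) :=
  ⟨by rw [potentialMeasure_univ ht]; exact ENNReal.ofReal_lt_top⟩

theorem ae_potentialMeasure (t : ℝ) : ∀ᵐ z ∂potentialMeasure t, ‖z‖ < 1 ∧ z ≠ 0 := by
  rw [potentialMeasure_eq_radialMeasure]
  filter_upwards [ae_radialMeasure_mem_ball _, ae_radialMeasure_ne_zero _] with z h1 h2
  exact ⟨mem_ball_zero_iff.1 h1, h2⟩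

theorem integrable_potentialMeasure {t : ℝ} (ht : -1 < t) {F : ℂ → ℝ}
    (hF : ContinuousOn F (ball 0 1)) {B : ℝ} (hB : ∀ z ∈ ball (0 : ℂ) 1, |F z| ≤ B) :
    Integrable F (potentialMeasure t) := by
  have := isFiniteMeasure_potentialMeasure ht
  refine Integrable.of_bound (C := B) ?_ ?_
  · rw [potentialMeasure_eq_radialMeasure]
    exact (hF.aestronglyMeasurable measurableSet_ball).mono_ac
      (radialMeasure_absolutelyContinuous _)
  · filter_upwards [ae_potentialMeasure t] with z hz using hB z (mem_ball_zero_iff.2 hz.1)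

/-- The potential measure is radial and finite, so `G` may be replaced by its circle averages, whose
comparison with `G 0` is governed by the sign of the Laplacian. -/
theorem integral_potentialMeasure_sub_eq {t : ℝ} (ht : -1 < t) {G : ℂ → ℝ}
    (hG : ContinuousOn G (ball 0 1)) {B : ℝ} (hB : ∀ z ∈ ball (0 : ℂ) 1, |G z| ≤ B) :
    Integrable (fun z => Real.circleAverage G 0 ‖z‖ - G 0) (potentialMeasure t) ∧
      ∫ z, (G z - G 0) ∂potentialMeasure t
        = ∫ z, (Real.circleAverage G 0 ‖z‖ - G 0) ∂potentialMeasure t := by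
  have := isFiniteMeasure_potentialMeasure ht
  have hi := integrable_potentialMeasure ht hG hB
  have hm : Measurable fun ρ => invWeight ρ * greenPotential t ρ :=
    measurable_invWeight.mul (measurable_greenPotential t)
  have h1 := integral_radialMeasure_eq_circleAverage hm hG
    (by rwa [← potentialMeasure_eq_radialMeasure])
  rw [← potentialMeasure_eq_radialMeasure] at h1
  refine ⟨h1.1.sub (integrable_const _), ?_⟩
  rw [integral_sub hi (integrable_const _), integral_sub h1.1 (integrable_const _), h1.2]

theorem integral_potentialMeasure_sub_nonneg {t : ℝ} (ht : -1 < t) {G : ℂ → ℝ}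
    (hG : ContDiffOn ℝ 2 G (ball 0 1)) {B : ℝ} (hB : ∀ z ∈ ball (0 : ℂ) 1, |G z| ≤ B)
    (h0 : ∀ z ∈ ball (0 : ℂ) 1, 0 ≤ Δ G z) : 0 ≤ ∫ z, (G z - G 0) ∂potentialMeasure t := by
  rw [(integral_potentialMeasure_sub_eq ht hG.continuousOn hB).2]
  refine integral_nonneg_of_ae ?_
  filter_upwards [ae_potentialMeasure t] with z hz
  exact sub_nonneg.2 (le_circleAverage_of_laplacian_nonneg (norm_pos_iff.2 hz.2) hz.1 hG
    fun x hx => h0 x (ball_subset_ball hz.1.le hx))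

theorem integral_potentialMeasure_sub_pos {t : ℝ} (ht : -1 < t) {G : ℂ → ℝ}
    (hG : ContDiffOn ℝ 2 G (ball 0 1)) {B : ℝ} (hB : ∀ z ∈ ball (0 : ℂ) 1, |G z| ≤ B)
    (h0 : ∀ z ∈ ball (0 : ℂ) 1, 0 ≤ Δ G z) (hpos : 0 < Δ G 0) :
    0 < ∫ z, (G z - G 0) ∂potentialMeasure t := by
  obtain ⟨hi, heq⟩ := integral_potentialMeasure_sub_eq ht hG.continuousOn hB
  refine (integral_potentialMeasure_sub_nonneg ht hG hB h0).lt_of_ne' fun h => ?_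
  have hlt : ∀ᵐ z ∂potentialMeasure t, 0 < Real.circleAverage G 0 ‖z‖ - G 0 := by
    filter_upwards [ae_potentialMeasure t] with z hz
    exact sub_pos.2 (lt_circleAverage_of_laplacian_pos (norm_pos_iff.2 hz.2) hz.1 hz.1 hG
      (fun x hx => h0 x (ball_subset_ball hz.1.le hx)) hpos)
  rw [heq, integral_eq_zero_iff_of_nonneg_ae (hlt.mono fun z hz => hz.le) hi] at h
  have h2 : ∀ᵐ z ∂potentialMeasure t, False := by
    filter_upwards [hlt, h] with z h1 h2 using h1.ne' h2
  rw [ae_iff] at h2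
  simp only [not_false_eq_true, Set.ofPred_true, potentialMeasure_univ ht,
    ENNReal.ofReal_eq_zero] at h2
  have : 0 < t + 1 := by linarith
  exact absurd h2 (not_le.2 (by positivity))

/-! ### The Hilbert–Schmidt norm in terms of the gradient and the Laplacian -/

theorem continuousOn_gradSq {g : ℂ → ℝ} (hg : ContDiffOn ℝ 2 g (ball 0 1)) :
    ContinuousOn (gradSq g) (ball 0 1) := by
  have h1 : ContinuousOn (fderiv ℝ g) (ball 0 1) :=
    hg.continuousOn_fderiv_of_isOpen isOpen_ball (by norm_num)
  exact ((h1.clm_apply continuousOn_const).pow 2).add ((h1.clm_apply continuousOn_const).pow 2)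

theorem gradSq_nonneg (g : ℂ → ℝ) (z : ℂ) : 0 ≤ gradSq g z := by
  unfold gradSq; positivity

/-- Derivatives within the closed disc are continuous on a compact set and agree with the ordinary
ones in the interior. This is the only use of regularity up to the boundary beyond boundedness of
the symbol. -/
theorem exists_bound_of_contDiffOn_closedBall {g : ℂ → ℝ}
    (hg : ContDiffOn ℝ 2 g (closedBall 0 1)) :
    ∃ B, 0 ≤ B ∧ ∀ z ∈ ball (0 : ℂ) 1, |g z| ≤ B ∧ gradSq g z ≤ B ∧ |Δ g z| ≤ B := by
  set S : Set ℂ := closedBall 0 1 with hS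
  have hSc : IsCompact S := isCompact_closedBall _ _
  have hSu : UniqueDiffOn ℝ S := by
    refine uniqueDiffOn_convex (convex_closedBall _ _) ?_
    rw [interior_closedBall _ one_ne_zero]
    exact ⟨0, mem_ball_self one_pos⟩
  have hmem : ∀ z ∈ ball (0 : ℂ) 1, S ∈ 𝓝 z := fun z hz =>
    mem_of_superset (isOpen_ball.mem_nhds hz) ball_subset_closedBall
  have h1 : ContDiffOn ℝ 1 (fderivWithin ℝ g S) S := hg.fderivWithin hSu (by norm_num)
  have h1c : ContinuousOn (fderivWithin ℝ g S) S := h1.continuousOn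
  have h2c : ContinuousOn (fderivWithin ℝ (fderivWithin ℝ g S) S) S :=
    h1.continuousOn_fderivWithin hSu le_rfl
  have he1 : ∀ z ∈ ball (0 : ℂ) 1, fderivWithin ℝ g S z = fderiv ℝ g z := fun z hz =>
    fderivWithin_of_mem_nhds (hmem z hz)
  have he2 : ∀ z ∈ ball (0 : ℂ) 1, fderivWithin ℝ (fderivWithin ℝ g S) S z
      = fderiv ℝ (fderiv ℝ g) z := by
    intro z hz
    rw [fderivWithin_of_mem_nhds (hmem z hz)]
    refine Filter.EventuallyEq.fderiv_eq ?_
    filter_upwards [isOpen_ball.mem_nhds hz] with x hx using he1 x hx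
  obtain ⟨B0, hB0⟩ := hSc.exists_bound_of_continuousOn hg.continuousOn
  obtain ⟨B1, hB1⟩ := hSc.exists_bound_of_continuousOn
    (((h1c.clm_apply (continuousOn_const (c := (1 : ℂ)))).pow 2).add
      ((h1c.clm_apply (continuousOn_const (c := Complex.I))).pow 2))
  obtain ⟨B2, hB2⟩ := hSc.exists_bound_of_continuousOn
    (((h2c.clm_apply (continuousOn_const (c := (1 : ℂ)))).clm_apply
      (continuousOn_const (c := (1 : ℂ)))).add
      ((h2c.clm_apply (continuousOn_const (c := Complex.I))).clm_apply
        (continuousOn_const (c := Complex.I))))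
  refine ⟨max (max B0 0) (max B1 B2), by simp, fun z hz => ?_⟩
  have hz' : z ∈ S := ball_subset_closedBall hz
  refine ⟨(hB0 z hz').trans (by simp), ?_, ?_⟩
  · refine (le_of_abs_le ?_).trans (b := B1) (by simp)
    simpa only [gradSq, Pi.add_apply, Pi.pow_apply, he1 z hz, Real.norm_eq_abs] using hB1 z hz'
  · refine le_trans (b := B2) ?_ (by simp)
    rw [laplacian_eq_fderiv_fderiv]
    simpa only [he2 z hz, Pi.add_apply, Real.norm_eq_abs] using hB2 z hz'

theorem integral_invMeasure (f : ℂ → ℝ) :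
    ∫ z, (1 - ‖z‖ ^ 2) ^ 2 * f z ∂invMeasure = ∫ z in ball (0 : ℂ) 1, f z := by
  have hm := measurable_invWeight
  have hlt : ∀ᵐ z ∂(volume.restrict (ball (0 : ℂ) 1)), invWeight ‖z‖ < ∞ :=
    Eventually.of_forall fun _ => ENNReal.ofReal_lt_top
  rw [invMeasure, radialMeasure, integral_withDensity_eq_integral_toReal_smul (by fun_prop) hlt]
  refine setIntegral_congr_fun measurableSet_ball fun z hz => ?_
  have h1 := one_sub_sq_norm_pos (mem_ball_zero_iff.1 hz)
  simp only [invWeight, smul_eq_mul]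
  rw [ENNReal.toReal_ofReal (by positivity)]
  field_simp

theorem integrable_invMeasure_iff (f : ℂ → ℝ) :
    Integrable (fun z => (1 - ‖z‖ ^ 2) ^ 2 * f z) invMeasure ↔ IntegrableOn f (ball 0 1) := by
  have hm := measurable_invWeight
  have hlt : ∀ᵐ z ∂(volume.restrict (ball (0 : ℂ) 1)), invWeight ‖z‖ < ∞ :=
    Eventually.of_forall fun _ => ENNReal.ofReal_lt_top
  rw [invMeasure, radialMeasure, integrable_withDensity_iff_integrable_smul' (by fun_prop) hlt]
  refine integrable_congr ?_
  filter_upwards [ae_restrict_mem measurableSet_ball] with z hz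
  have h1 := one_sub_sq_norm_pos (mem_ball_zero_iff.1 hz)
  simp only [invWeight, smul_eq_mul]
  rw [ENNReal.toReal_ofReal (by positivity)]
  field_simp

theorem aestronglyMeasurable_invMeasure {F : ℂ → ℝ} (hF : ContinuousOn F (ball 0 1)) :
    AEStronglyMeasurable F invMeasure :=
  (hF.aestronglyMeasurable measurableSet_ball).mono_ac (radialMeasure_absolutelyContinuous _)

theorem ae_greenPotential_lt_top {t : ℝ} (ht : -1 < t) :
    ∀ᵐ z ∂invMeasure, greenPotential t ‖z‖ < ∞ := by
  filter_upwards [ae_radialMeasure_ne_zero invWeight] with z hz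
  exact greenPotential_lt_top ht (norm_pos_iff.2 hz)

theorem integral_potentialMeasure {t : ℝ} (ht : -1 < t) (f : ℂ → ℝ) :
    ∫ z, f z ∂potentialMeasure t = ∫ z, f z * (greenPotential t ‖z‖).toReal ∂invMeasure := by
  have := measurable_greenPotential t
  rw [potentialMeasure, integral_withDensity_eq_integral_toReal_smul (by fun_prop)
    (ae_greenPotential_lt_top ht)]
  simp only [smul_eq_mul, mul_comm]

theorem measurable_greenPotential_mob (t : ℝ) :
    Measurable fun p : ℂ × ℂ => (greenPotential t ‖mob p.1 p.2‖).toReal := by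
  have := measurable_greenPotential t
  have := measurable_mob
  fun_prop

/-- Integrate over the first point: by symmetry of `|mob w x|` and invariance of the measure the
result is a constant, and `(1 - |x|²)²` times the invariant measure is Lebesgue measure on the disc,
which is finite. -/
theorem integrable_greenPotential_mob {t : ℝ} (ht : -1 < t) :
    Integrable (fun p : ℂ × ℂ => (1 - ‖p.2‖ ^ 2) ^ 2 * (greenPotential t ‖mob p.1 p.2‖).toReal)
      (invMeasure.prod invMeasure) := by
  have hm1 := measurable_greenPotential t
  have hm2 := measurable_mob
  have hm : Measurable fun p : ℂ × ℂ =>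
      (1 - ‖p.2‖ ^ 2) ^ 2 * (greenPotential t ‖mob p.1 p.2‖).toReal := by fun_prop
  refine ⟨hm.aestronglyMeasurable, ?_⟩
  rw [hasFiniteIntegral_iff_ofReal (Eventually.of_forall fun p =>
    mul_nonneg (by positivity) ENNReal.toReal_nonneg)]
  have h1 : ∫⁻ p : ℂ × ℂ, ENNReal.ofReal ((1 - ‖p.2‖ ^ 2) ^ 2 *
        (greenPotential t ‖mob p.1 p.2‖).toReal) ∂(invMeasure.prod invMeasure)
      ≤ ∫⁻ p : ℂ × ℂ, ENNReal.ofReal ((1 - ‖p.2‖ ^ 2) ^ 2) * greenPotential t ‖mob p.1 p.2‖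
        ∂(invMeasure.prod invMeasure) := by
    refine lintegral_mono fun p => ?_
    simp only
    rw [ENNReal.ofReal_mul (by positivity)]
    gcongr
    exact ENNReal.ofReal_toReal_le
  refine h1.trans_lt ?_
  rw [lintegral_prod_symm _ (by fun_prop)]
  have h2 : ∀ᵐ x ∂invMeasure, ∫⁻ w, ENNReal.ofReal ((1 - ‖x‖ ^ 2) ^ 2) *
      greenPotential t ‖mob w x‖ ∂invMeasure
      = ENNReal.ofReal ((1 - ‖x‖ ^ 2) ^ 2) * ENNReal.ofReal (1 / (4 * (t + 1))) := by
    filter_upwards [ae_invMeasure_mem_ball] with x hx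
    rw [lintegral_const_mul' _ _ ENNReal.ofReal_ne_top]
    simp only [norm_mob_comm (z := x)]
    rw [(measurePreserving_mob hx).lintegral_comp (f := fun z => greenPotential t ‖z‖)
      (by fun_prop), lintegral_greenPotential_invMeasure ht]
  rw [lintegral_congr_ae h2, lintegral_mul_const _ (by fun_prop)]
  refine ENNReal.mul_lt_top ?_ ENNReal.ofReal_lt_top
  have h3 : Integrable (fun z : ℂ => (1 - ‖z‖ ^ 2) ^ 2 * (1 : ℝ)) invMeasure :=
    (integrable_invMeasure_iff _).2 (integrableOn_const measure_ball_lt_top.ne)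
  have h4 := h3.2
  rw [hasFiniteIntegral_iff_ofReal (Eventually.of_forall fun z => by simp only [mul_one]; exact sq_nonneg _)] at h4
  simpa only [mul_one] using h4

/-- The mean value defect of `g` at `x`, with respect to the image of the potential measure. -/
def meanDefect (t : ℝ) (g : ℂ → ℝ) (x : ℂ) : ℝ :=
  ∫ z, (g (mob x z) - g x) ∂potentialMeasure t

/-- Green's formula is applied to `(g ∘ mob w - g w)²`, which vanishes at `0`; then `x = mob w ξ` is
substituted. The conformal factor and the density of the invariant measure combine into `(1 -
|x|²)²`. -/
theorem integral_sub_sq_comp_mob {t : ℝ} (ht : -1 < t) {g : ℂ → ℝ}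
    (hg : ContDiffOn ℝ 2 g (ball 0 1)) {B : ℝ} (hB0 : 0 ≤ B)
    (hB : ∀ z ∈ ball (0 : ℂ) 1, |g z| ≤ B ∧ gradSq g z ≤ B ∧ |Δ g z| ≤ B) {w : ℂ}
    (hw : ‖w‖ < 1) :
    Integrable (fun ξ => (g (mob w ξ) - g w) ^ 2) (weightedMeasure t) ∧
    ∫ ξ, (g (mob w ξ) - g w) ^ 2 ∂weightedMeasure t
      = ∫ x, (1 - ‖x‖ ^ 2) ^ 2 * (greenPotential t ‖mob w x‖).toReal *
          (2 * (gradSq g x + (g x - g w) * Δ g x)) ∂invMeasure := by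
  have hprob := isProbabilityMeasure_weightedMeasure ht
  have hwm : w ∈ ball (0 : ℂ) 1 := mem_ball_zero_iff.2 hw
  have hG : ContDiffOn ℝ 2 (fun ξ => g (mob w ξ)) (ball 0 1) :=
    hg.comp (contDiffOn_mob hw) (mapsTo_mob hw)
  have hF : ContDiffOn ℝ 2 (fun ξ => (g (mob w ξ) - g w) ^ 2) (ball 0 1) :=
    (hG.sub contDiffOn_const).pow 2
  have hFb : ∀ z ∈ ball (0 : ℂ) 1, |g z - g w| ≤ 2 * B := by
    intro z hz
    refine (abs_sub _ _).trans ?_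
    linarith [(hB z hz).1, (hB w hwm).1]
  have hFi : Integrable (fun ξ => (g (mob w ξ) - g w) ^ 2) (weightedMeasure t) := by
    refine Integrable.of_bound (C := (2 * B) ^ 2)
      (aestronglyMeasurable_weightedMeasure t hF.continuousOn) ?_
    filter_upwards [ae_weightedMeasure_mem_ball t] with z hz
    rw [norm_pow, Real.norm_eq_abs]
    have := hFb _ (mapsTo_mob hw (mem_ball_zero_iff.2 hz))
    gcongr
  refine ⟨hFi, ?_⟩
  have hΔ : ∀ z ∈ ball (0 : ℂ) 1, Δ (fun ξ => (g (mob w ξ) - g w) ^ 2) z = ‖mobDeriv w z‖ ^ 2 *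
      (2 * (gradSq g (mob w z) + (g (mob w z) - g w) * Δ g (mob w z))) := by
    intro z hz
    have hz' := mem_ball_zero_iff.1 hz
    rw [laplacian_sub_sq (G := fun ξ => g (mob w ξ)) (hG.contDiffAt (isOpen_ball.mem_nhds hz)),
      gradSq_comp_mob hg hw hz', laplacian_comp_mob hg hw hz']
    ring
  -- For fixed `w` the pole of `mob w` lies outside the closed disc, so the conformal factor is
  -- bounded and the Laplacian satisfies the bound Green's formula needs.
  have hmd : ContinuousOn (fun z => ‖mobDeriv w z‖) (closedBall 0 1) := by
    refine ContinuousOn.norm ?_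
    unfold mobDeriv
    refine continuousOn_const.div (by fun_prop) fun z hz => pow_ne_zero 2 ?_
    intro h0
    have h1 : ‖(starRingEnd ℂ) w * z‖ < 1 := by
      rw [norm_mul, RCLike.norm_conj]
      have := mem_closedBall_zero_iff.1 hz
      nlinarith [norm_nonneg w, norm_nonneg z]
    rw [← sub_eq_zero.1 h0, norm_one] at h1
    exact lt_irrefl _ h1
  obtain ⟨A, hA⟩ := (isCompact_closedBall (0 : ℂ) 1).exists_bound_of_continuousOn hmd
  have hΦ : ∀ x ∈ ball (0 : ℂ) 1, |2 * (gradSq g x + (g x - g w) * Δ g x)|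
      ≤ 2 * (B + 2 * B * B) := by
    intro x hx
    rw [abs_mul, abs_two]
    have h1 : |gradSq g x| ≤ B := by rw [abs_of_nonneg (gradSq_nonneg g x)]; exact (hB x hx).2.1
    have h2 : |(g x - g w) * Δ g x| ≤ 2 * B * B := by
      rw [abs_mul]
      exact mul_le_mul (hFb x hx) (hB x hx).2.2 (abs_nonneg _) (by positivity)
    have := abs_add_le (gradSq g x) ((g x - g w) * Δ g x)
    linarith
  have hL : ∀ z ∈ ball (0 : ℂ) 1, |Δ (fun ξ => (g (mob w ξ) - g w) ^ 2) z|
      ≤ A ^ 2 * (2 * (B + 2 * B * B)) := by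
    intro z hz
    rw [hΔ z hz, abs_mul, abs_pow, abs_norm]
    have h1 := hA z (ball_subset_closedBall hz)
    rw [norm_norm] at h1
    exact mul_le_mul (by gcongr) (hΦ _ (mapsTo_mob hw hz)) (abs_nonneg _) (by positivity)
  have h1 := integral_weightedMeasure_sub_eq_laplacian ht hF hFi hL
  simp only [mob_zero, sub_self, ne_eq, OfNat.ofNat_ne_zero, not_false_eq_true, zero_pow,
    sub_zero] at h1
  rw [h1, ← integral_invMeasure]
  have hmob := measurable_mob_right w
  have hN := measurable_greenPotential t
  refine (integral_congr_ae ?_).trans (integral_comp_mob hw (f := fun x =>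
    (1 - ‖x‖ ^ 2) ^ 2 * (greenPotential t ‖mob w x‖).toReal *
      (2 * (gradSq g x + (g x - g w) * Δ g x))) ?_)
  · filter_upwards [ae_invMeasure_mem_ball] with z hz
    rw [hΔ z (mem_ball_zero_iff.2 hz), mob_mob hw hz, ← one_sub_sq_norm_mul_mobDeriv hw hz]
    ring
  · have hNm : Measurable fun x : ℂ =>
        (1 - ‖x‖ ^ 2) ^ 2 * (greenPotential t ‖mob w x‖).toReal := by fun_prop
    refine hNm.aestronglyMeasurable.mul (aestronglyMeasurable_invMeasure ?_)
    exact continuousOn_const.mul ((continuousOn_gradSq hg).add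
      ((hg.continuousOn.sub continuousOn_const).mul (continuousOn_laplacian hg)))

/-- Fubini, integrating over `w` first. The gradient at `x` does not depend on `w` and meets only
the total mass of the potential measure; the other term becomes `-Δ g x` times the mean defect at
`x`. -/
theorem integral_invMeasure_sub_sq {t : ℝ} (ht : -1 < t) {g : ℂ → ℝ}
    (hg : ContDiffOn ℝ 2 g (ball 0 1)) {B : ℝ} (hB0 : 0 ≤ B)
    (hB : ∀ z ∈ ball (0 : ℂ) 1, |g z| ≤ B ∧ gradSq g z ≤ B ∧ |Δ g z| ≤ B) :
    Integrable (fun w => ∫ ξ, (g (mob w ξ) - g w) ^ 2 ∂weightedMeasure t) invMeasure ∧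
    IntegrableOn (gradSq g) (ball 0 1) ∧
    IntegrableOn (fun x => Δ g x * meanDefect t g x) (ball 0 1) ∧
    ∫ w, (∫ ξ, (g (mob w ξ) - g w) ^ 2 ∂weightedMeasure t) ∂invMeasure
      = 2 * (1 / (4 * (t + 1)) * (∫ x in ball (0 : ℂ) 1, gradSq g x)
          - ∫ x in ball (0 : ℂ) 1, Δ g x * meanDefect t g x) := by
  have ht1 : 0 < t + 1 := by linarith
  have hfin := isFiniteMeasure_potentialMeasure ht
  have hgm := aestronglyMeasurable_invMeasure hg.continuousOn
  have hqm := aestronglyMeasurable_invMeasure (continuousOn_gradSq hg)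
  have hlm := aestronglyMeasurable_invMeasure (continuousOn_laplacian hg)
  have hint : Integrable (fun p : ℂ × ℂ =>
      (1 - ‖p.2‖ ^ 2) ^ 2 * (greenPotential t ‖mob p.1 p.2‖).toReal *
        (2 * (gradSq g p.2 + (g p.2 - g p.1) * Δ g p.2))) (invMeasure.prod invMeasure) := by
    refine (integrable_greenPotential_mob ht).mul_bdd (c := 2 * (B + 2 * B * B)) ?_ ?_
    · exact ((hqm.comp_snd).add ((hgm.comp_snd.sub hgm.comp_fst).mul hlm.comp_snd)).const_mul 2
    · have h1 : ∀ᵐ p : ℂ × ℂ ∂(invMeasure.prod invMeasure), ‖p.1‖ < 1 :=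
        Measure.quasiMeasurePreserving_fst.ae ae_invMeasure_mem_ball
      have h2 : ∀ᵐ p : ℂ × ℂ ∂(invMeasure.prod invMeasure), ‖p.2‖ < 1 :=
        Measure.quasiMeasurePreserving_snd.ae ae_invMeasure_mem_ball
      filter_upwards [h1, h2] with p hp1 hp2
      have hb1 := hB p.1 (mem_ball_zero_iff.2 hp1)
      have hb2 := hB p.2 (mem_ball_zero_iff.2 hp2)
      rw [Real.norm_eq_abs, abs_mul, abs_two]
      have h3 : |gradSq g p.2| ≤ B := by rw [abs_of_nonneg (gradSq_nonneg g p.2)]; exact hb2.2.1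
      have h4 : |g p.2 - g p.1| ≤ 2 * B := (abs_sub _ _).trans (by linarith [hb1.1, hb2.1])
      have h5 : |(g p.2 - g p.1) * Δ g p.2| ≤ 2 * B * B := by
        rw [abs_mul]
        exact mul_le_mul h4 hb2.2.2 (abs_nonneg _) (by positivity)
      have := abs_add_le (gradSq g p.2) ((g p.2 - g p.1) * Δ g p.2)
      linarith
  have hJ : ∀ᵐ w ∂invMeasure, ∫ x, (1 - ‖x‖ ^ 2) ^ 2 * (greenPotential t ‖mob w x‖).toReal *
      (2 * (gradSq g x + (g x - g w) * Δ g x)) ∂invMeasure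
      = ∫ ξ, (g (mob w ξ) - g w) ^ 2 ∂weightedMeasure t := by
    filter_upwards [ae_invMeasure_mem_ball] with w hw
    exact (integral_sub_sq_comp_mob ht hg hB0 hB hw).2.symm
  have hI : ∀ᵐ x ∂invMeasure, ∫ w, (1 - ‖x‖ ^ 2) ^ 2 * (greenPotential t ‖mob w x‖).toReal *
      (2 * (gradSq g x + (g x - g w) * Δ g x)) ∂invMeasure
      = (1 - ‖x‖ ^ 2) ^ 2 * (2 * (1 / (4 * (t + 1)) * gradSq g x - Δ g x * meanDefect t g x)) := by
    filter_upwards [ae_invMeasure_mem_ball] with x hx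
    have hN := measurable_greenPotential t
    have hcm : ContinuousOn (fun z => g (mob x z)) (ball 0 1) :=
      hg.continuousOn.comp (contDiffOn_mob hx).continuousOn (mapsTo_mob hx)
    have hgi : Integrable (fun z => g (mob x z)) (potentialMeasure t) :=
      integrable_potentialMeasure ht hcm fun z hz => (hB _ (mapsTo_mob hx hz)).1
    have h1 : ∀ w, (1 - ‖x‖ ^ 2) ^ 2 * (greenPotential t ‖mob w x‖).toReal *
        (2 * (gradSq g x + (g x - g w) * Δ g x))
        = ((1 - ‖x‖ ^ 2) ^ 2 * 2) * ((gradSq g x + (g x - g w) * Δ g x) *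
          (greenPotential t ‖mob x w‖).toReal) := by
      intro w
      rw [norm_mob_comm (w := w)]
      ring
    simp only [h1]
    have hgi2 : Integrable (fun z => (g (mob x z) - g x) * Δ g x) (potentialMeasure t) :=
      (hgi.sub (integrable_const _)).mul_const _
    rw [integral_const_mul, ← integral_comp_mob hx (f := fun w =>
      (gradSq g x + (g x - g w) * Δ g x) * (greenPotential t ‖mob x w‖).toReal)]
    · have h2 : ∀ᵐ z ∂invMeasure, (gradSq g x + (g x - g (mob x z)) * Δ g x) *
          (greenPotential t ‖mob x (mob x z)‖).toReal
          = (gradSq g x - (g (mob x z) - g x) * Δ g x) * (greenPotential t ‖z‖).toReal := by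
        filter_upwards [ae_invMeasure_mem_ball] with z hz
        rw [mob_mob hx hz]
        ring
      rw [integral_congr_ae h2, ← integral_potentialMeasure ht,
        integral_sub (integrable_const _) hgi2,
        integral_const, integral_mul_const, ← meanDefect, measureReal_def, potentialMeasure_univ ht,
        ENNReal.toReal_ofReal (by positivity), smul_eq_mul]
      ring
    · have hNm : Measurable fun w : ℂ => (greenPotential t ‖mob x w‖).toReal := by
        have := measurable_mob_right x
        fun_prop
      refine AEStronglyMeasurable.mul (aestronglyMeasurable_invMeasure ?_) hNm.aestronglyMeasurable
      exact continuousOn_const.add ((continuousOn_const.sub hg.continuousOn).mul continuousOn_const)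
  have hq : IntegrableOn (gradSq g) (ball 0 1) := by
    refine IntegrableOn.of_bound measure_ball_lt_top
      ((continuousOn_gradSq hg).aestronglyMeasurable measurableSet_ball) B ?_
    filter_upwards [ae_restrict_mem measurableSet_ball] with z hz
    rw [Real.norm_of_nonneg (gradSq_nonneg g z)]
    exact (hB z hz).2.1
  -- Integrability involving `meanDefect` is read off from Fubini, with no regularity of
  -- `meanDefect` to establish.
  have hqd : IntegrableOn
      (fun x => 2 * (1 / (4 * (t + 1)) * gradSq g x - Δ g x * meanDefect t g x)) (ball 0 1) :=
    (integrable_invMeasure_iff _).1 (hint.integral_prod_right.congr hI)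
  have hld : IntegrableOn (fun x => Δ g x * meanDefect t g x) (ball 0 1) := by
    refine ((hq.const_mul (1 / (4 * (t + 1)))).sub (hqd.const_mul 2⁻¹)).congr ?_
    refine Eventually.of_forall fun x => ?_
    simp only [Pi.sub_apply]
    ring
  refine ⟨hint.integral_prod_left.congr hJ, hq, hld, ?_⟩
  rw [← integral_congr_ae hJ, integral_integral_swap hint, integral_congr_ae hI,
    integral_invMeasure, integral_const_mul, integral_sub (hq.const_mul _) hld, integral_const_mul]

/-- The constant is `(t + 1) / (2π) · 2 · 1 / (4 (t + 1)) = 1 / (4π)`. Nonnegativity is recorded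
because `ENNReal.ofReal` truncates negative numbers, and the equality case must return to real
numbers. -/
theorem hsNormSq_hankel_eq {t : ℝ} (ht : -1 < t) {g : ℂ → ℝ}
    (hg : ContDiffOn ℝ 2 g (ball 0 1)) {B : ℝ} (hB0 : 0 ≤ B)
    (hB : ∀ z ∈ ball (0 : ℂ) 1, |g z| ≤ B ∧ gradSq g z ≤ B ∧ |Δ g z| ≤ B)
    (hgm : MemLp (fun z => (g z : ℂ)) ∞ (weightedMeasure t)) :
    0 ≤ 1 / (4 * Real.pi) * (∫ x in ball (0 : ℂ) 1, gradSq g x)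
        - (t + 1) / Real.pi * ∫ x in ball (0 : ℂ) 1, Δ g x * meanDefect t g x ∧
    hsNormSq (hankel t _ hgm) = ENNReal.ofReal (1 / (4 * Real.pi) *
      (∫ x in ball (0 : ℂ) 1, gradSq g x)
        - (t + 1) / Real.pi * ∫ x in ball (0 : ℂ) 1, Δ g x * meanDefect t g x) := by
  have ht1 : 0 < t + 1 := by linarith
  obtain ⟨hJi, -, -, hJ⟩ := integral_invMeasure_sub_sq ht hg hB0 hB
  have h1 : 1 / (4 * Real.pi) * (∫ x in ball (0 : ℂ) 1, gradSq g x)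
        - (t + 1) / Real.pi * ∫ x in ball (0 : ℂ) 1, Δ g x * meanDefect t g x
      = (t + 1) / Real.pi / 2 *
        ∫ w, (∫ ξ, (g (mob w ξ) - g w) ^ 2 ∂weightedMeasure t) ∂invMeasure := by
    rw [hJ]
    field_simp
  rw [h1]
  refine ⟨by positivity, ?_⟩
  have h2 := two_mul_hsNormSq_hankel ht hg.continuousOn hgm
  have h3 : ∀ᵐ w ∂invMeasure, ∫⁻ ξ, ENNReal.ofReal ((g (mob w ξ) - g w) ^ 2) ∂weightedMeasure t
      = ENNReal.ofReal (∫ ξ, (g (mob w ξ) - g w) ^ 2 ∂weightedMeasure t) := by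
    filter_upwards [ae_invMeasure_mem_ball] with w hw
    rw [ofReal_integral_eq_lintegral_ofReal (integral_sub_sq_comp_mob ht hg hB0 hB hw).1
      (Eventually.of_forall fun ξ => sq_nonneg _)]
  rw [lintegral_congr_ae h3, ← ofReal_integral_eq_lintegral_ofReal hJi
    (Eventually.of_forall fun w => integral_nonneg fun ξ => sq_nonneg _),
    ← ENNReal.ofReal_mul (by positivity)] at h2
  have h4 : hsNormSq (hankel t _ hgm) = 2⁻¹ * (2 * hsNormSq (hankel t _ hgm)) := by
    rw [← mul_assoc, ENNReal.inv_mul_cancel (by norm_num) (by norm_num), one_mul]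
  rw [h4, h2, ← ENNReal.ofReal_ofNat 2, ← ENNReal.ofReal_inv_of_pos (by norm_num),
    ← ENNReal.ofReal_mul (by norm_num)]
  congr 1
  ring

/-! ### Sign of the defect and the equality case. -/

theorem norm_dbar_sq {g : ℂ → ℝ} {z : ℂ} (hg : DifferentiableAt ℝ g z) :
    ‖dbar (fun w => (g w : ℂ)) z‖ ^ 2 = gradSq g z / 4 := by
  have h1 : HasFDerivAt (fun w => (g w : ℂ)) (Complex.ofRealCLM.comp (fderiv ℝ g z)) z :=
    Complex.ofRealCLM.hasFDerivAt.comp z hg.hasFDerivAt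
  rw [dbar, h1.fderiv, ← Complex.normSq_eq_norm_sq, gradSq]
  simp only [ContinuousLinearMap.comp_apply, Complex.ofRealCLM_apply, map_mul,
    Complex.normSq_apply]
  simp
  ring

/-- The defect is the integral of `G - G 0` for `G = g ∘ mob x`, whose Laplacian is again
nonnegative. At `0` that Laplacian is `(1 - |x|²)² Δ g x`, so strict positivity carries over. -/
theorem meanDefect_nonneg {t : ℝ} (ht : -1 < t) {g : ℂ → ℝ} (hg : ContDiffOn ℝ 2 g (ball 0 1))
    {B : ℝ} (hB : ∀ z ∈ ball (0 : ℂ) 1, |g z| ≤ B) (h0 : ∀ z ∈ ball (0 : ℂ) 1, 0 ≤ Δ g z) {x : ℂ}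
    (hx : x ∈ ball (0 : ℂ) 1) : 0 ≤ meanDefect t g x ∧ (0 < Δ g x → 0 < meanDefect t g x) := by
  have hx' := mem_ball_zero_iff.1 hx
  have hG : ContDiffOn ℝ 2 (fun z => g (mob x z)) (ball 0 1) :=
    hg.comp (contDiffOn_mob hx') (mapsTo_mob hx')
  have hGB : ∀ z ∈ ball (0 : ℂ) 1, |g (mob x z)| ≤ B := fun z hz => hB _ (mapsTo_mob hx' hz)
  have hΔ : ∀ z ∈ ball (0 : ℂ) 1, 0 ≤ Δ (fun z => g (mob x z)) z := by
    intro z hz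
    rw [laplacian_comp_mob hg hx' (mem_ball_zero_iff.1 hz)]
    exact mul_nonneg (by positivity) (h0 _ (mapsTo_mob hx' hz))
  have h1 := integral_potentialMeasure_sub_nonneg ht hG hGB hΔ
  have h2 := integral_potentialMeasure_sub_pos ht hG hGB hΔ
  simp only [mob_zero] at h1 h2
  refine ⟨h1, fun hpos => h2 ?_⟩
  rw [laplacian_comp_mob hg hx' (by simp), mob_zero]
  refine mul_pos (pow_pos (norm_pos_iff.2 ?_) 2) hpos
  have h3 := (one_sub_sq_norm_pos hx').ne'
  simp only [mobDeriv, mul_zero, sub_zero, one_pow, div_one, ne_eq, neg_eq_zero]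
  exact_mod_cast h3

/-- A point with `Δ g > 0` would have a disc around it on which both factors of the integrand are
positive, contradicting that the nonnegative integrand vanishes almost everywhere. -/
theorem harmonicOnNhd_of_setIntegral_eq_zero {t : ℝ} (ht : -1 < t) {g : ℂ → ℝ}
    (hg : ContDiffOn ℝ 2 g (ball 0 1)) {B : ℝ} (hB : ∀ z ∈ ball (0 : ℂ) 1, |g z| ≤ B)
    (h0 : ∀ z ∈ ball (0 : ℂ) 1, 0 ≤ Δ g z)
    (hi : IntegrableOn (fun x => Δ g x * meanDefect t g x) (ball 0 1))
    (hz : ∫ x in ball (0 : ℂ) 1, Δ g x * meanDefect t g x = 0) :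
    InnerProductSpace.HarmonicOnNhd g (ball 0 1) := by
  have hnn : 0 ≤ᵐ[volume.restrict (ball (0 : ℂ) 1)] fun x => Δ g x * meanDefect t g x := by
    filter_upwards [ae_restrict_mem measurableSet_ball] with x hx
    exact mul_nonneg (h0 x hx) (meanDefect_nonneg ht hg hB h0 hx).1
  rw [integral_eq_zero_iff_of_nonneg_ae hnn hi] at hz
  have hzero : ∀ c ∈ ball (0 : ℂ) 1, Δ g c = 0 := by
    intro c hc
    by_contra hne
    have hpos : 0 < Δ g c := (h0 c hc).lt_of_ne' hne
    have h1 := ((continuousOn_laplacian hg).continuousAt (isOpen_ball.mem_nhds hc)).eventually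
      (lt_mem_nhds hpos)
    obtain ⟨ε, hε, hεr⟩ := Metric.eventually_nhds_iff_ball.1 (h1.and (isOpen_ball.mem_nhds hc))
    have h3 : ∀ᵐ z ∂(volume.restrict (ball c ε)), False := by
      filter_upwards [ae_restrict_mem measurableSet_ball,
        ae_mono (Measure.restrict_mono (fun z hz => (hεr z hz).2) le_rfl) hz] with z hz1 hz2
      obtain ⟨h4, h5⟩ := hεr z hz1
      exact (mul_pos h4 ((meanDefect_nonneg ht hg hB h0 h5).2 h4)).ne' hz2
    rw [ae_iff] at h3
    simp only [not_false_eq_true, Set.ofPred_true, Measure.restrict_apply_univ] at h3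
    exact (measure_ball_pos volume c hε).ne' h3
  intro x hx
  refine ⟨hg.contDiffAt (isOpen_ball.mem_nhds hx), ?_⟩
  filter_upwards [isOpen_ball.mem_nhds hx] with y hy using hzero y hy

end

end BergmanHankel

theorem mainTheorem5 (t : ℝ) (ht : -1 < t) (g : ℂ → ℝ)
    (hg : ContDiffOn ℝ 2 g (Metric.closedBall 0 1))
    (hsub : BergmanHankel.IsSubharmonicOn g (Metric.ball 0 1)) :
    MeasureTheory.IntegrableOn
        (fun z => ‖BergmanHankel.dbar (fun w => (g w : ℂ)) z‖ ^ 2) (Metric.ball 0 1) ∧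
      BergmanHankel.hsNormSq (BergmanHankel.hankel t (fun z => (g z : ℂ))
          (BergmanHankel.memLp_top_of_contDiffOn t hg)) ≤
        ENNReal.ofReal (1 / Real.pi *
          ∫ z in Metric.ball (0 : ℂ) 1, ‖BergmanHankel.dbar (fun w => (g w : ℂ)) z‖ ^ 2) ∧
      (BergmanHankel.hsNormSq (BergmanHankel.hankel t (fun z => (g z : ℂ))
          (BergmanHankel.memLp_top_of_contDiffOn t hg)) =
        ENNReal.ofReal (1 / Real.pi *
          ∫ z in Metric.ball (0 : ℂ) 1, ‖BergmanHankel.dbar (fun w => (g w : ℂ)) z‖ ^ 2) ↔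
        InnerProductSpace.HarmonicOnNhd g (Metric.ball 0 1)) := by
  have hgb : ContDiffOn ℝ 2 g (Metric.ball 0 1) := hg.mono Metric.ball_subset_closedBall
  obtain ⟨B, hB0, hB⟩ := BergmanHankel.exists_bound_of_contDiffOn_closedBall hg
  have hΔ : ∀ z ∈ Metric.ball (0 : ℂ) 1, 0 ≤ Laplacian.laplacian g z := fun z hz =>
    BergmanHankel.laplacian_nonneg_of_isSubharmonicOn hgb hsub hz
  obtain ⟨-, hq, hld, -⟩ := BergmanHankel.integral_invMeasure_sub_sq ht hgb hB0 hB
  obtain ⟨hnn, hs⟩ := BergmanHankel.hsNormSq_hankel_eq ht hgb hB0 hB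
    (BergmanHankel.memLp_top_of_contDiffOn t hg)
  have hd : ∀ z ∈ Metric.ball (0 : ℂ) 1, ‖BergmanHankel.dbar (fun w => (g w : ℂ)) z‖ ^ 2
      = BergmanHankel.gradSq g z / 4 := fun z hz => BergmanHankel.norm_dbar_sq
    ((hgb.contDiffAt (Metric.isOpen_ball.mem_nhds hz)).differentiableAt (by norm_num))
  have hdint : 1 / Real.pi *
      ∫ z in Metric.ball (0 : ℂ) 1, ‖BergmanHankel.dbar (fun w => (g w : ℂ)) z‖ ^ 2
      = 1 / (4 * Real.pi) * ∫ z in Metric.ball (0 : ℂ) 1, BergmanHankel.gradSq g z := by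
    rw [MeasureTheory.setIntegral_congr_fun measurableSet_ball hd,
      MeasureTheory.integral_div]
    ring
  have hE : 0 ≤ ∫ x in Metric.ball (0 : ℂ) 1,
      Laplacian.laplacian g x * BergmanHankel.meanDefect t g x :=
    MeasureTheory.setIntegral_nonneg measurableSet_ball fun x hx => mul_nonneg (hΔ x hx)
      (BergmanHankel.meanDefect_nonneg ht hgb (fun z hz => (hB z hz).1) hΔ hx).1
  have hA : 0 ≤ ∫ z in Metric.ball (0 : ℂ) 1, BergmanHankel.gradSq g z :=
    MeasureTheory.integral_nonneg fun z => BergmanHankel.gradSq_nonneg g z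
  have hc : 0 < (t + 1) / Real.pi := div_pos (by linarith) Real.pi_pos
  refine ⟨?_, ?_, ?_⟩
  · exact (MeasureTheory.integrableOn_congr_fun hd measurableSet_ball).2 (hq.div_const 4)
  -- The right side is finite, so this bound also contains the assertion that the operator is
  -- Hilbert–Schmidt.
  · rw [hs, hdint]
    refine ENNReal.ofReal_le_ofReal ?_
    linarith [mul_nonneg hc.le hE]
  -- Both real numbers are nonnegative, so equality amounts to vanishing of the defect integral.
  · rw [hs, hdint, ENNReal.ofReal_eq_ofReal_iff hnn (by positivity)]
    constructor
    · intro h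
      have h1 : (t + 1) / Real.pi * ∫ x in Metric.ball (0 : ℂ) 1,
          Laplacian.laplacian g x * BergmanHankel.meanDefect t g x = 0 := by linarith
      exact BergmanHankel.harmonicOnNhd_of_setIntegral_eq_zero ht hgb (fun z hz => (hB z hz).1) hΔ
        hld ((mul_eq_zero.1 h1).resolve_left hc.ne')
    · intro h
      have h1 : ∫ x in Metric.ball (0 : ℂ) 1,
          Laplacian.laplacian g x * BergmanHankel.meanDefect t g x = 0 := by
        refine (MeasureTheory.setIntegral_congr_fun (g := fun _ => (0 : ℝ)) measurableSet_ball
          fun x hx => ?_).trans (by simp)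
        have h2 : Laplacian.laplacian g x = 0 := (h x hx).2.self_of_nhds
        simp only [h2, zero_mul]
      rw [h1, mul_zero, sub_zero]
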